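/- Let $X,Y$ be Banach spaces, $\Omega\subseteq X$ open, $f:\Omega\to Y$ analytic, and $F:X\rightrightarrows Y$ a set-valued mapping with closed graph. Write $B(\cdot,\cdot)$ and $B[\cdot,\cdot]$ for open and closed balls, put $L_f(x,y)=f(x)+f'(x)(y-x)+F(y)$ for $x\in\Omega$, $y\in X$, and $L_f(x,z)^{-1}=\{y\in X: z\in L_f(x,y)\}$ for $z\in Y$. Let $x_0,x_1\in\Omega$ and $\lambda>0$ be such that $L_f(x_0,\cdot)$ is strongly regular at $x_1$ for $0$ with Lipschitz constant $\lambda$; that is, $0\in L_f(x_0,x_1)$ and there are $r,\rho>0$ such that for every $z\in B(0,\rho)$ the set $L_f(x_0,z)^{-1}\cap B(x_1,r)$ consists of exactly one point, which depends on $z$ in a Lipschitz way with modulus $\lambda$. Suppose that $$\gamma:=\sup_{n>1}\left\|\frac{\lambda f^{(n)}(x_0)}{n!}\right\|^{1/(n-1)}$$ is finite and positive, that $B(x_0,1/\gamma)\subseteq\Omega$, and that $b>0$ satisfies $\|x_1-x_0\|\le b$ and $b\gamma\le 3-2\sqrt2$. Then there exist constants $r_{x_1},r_0,r_{x_0}>0$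 with the following property: (R) for every $x\in B(x_0,r_{x_0})\cap\Omega$ one has $\lambda\|f'(x)-f'(x_0)\|<1$, and for every $z\in B(0,r_0)$ the set $L_f(x,z)^{-1}\cap B(x_1,r_{x_1})$ consists of exactly one point, which depends on $z\in B(0,r_0)$ in a Lipschitz way with modulus $\lambda/(1-\lambda\|f'(x)-f'(x_0)\|)$. Let $r_{x_1},r_0,r_{x_0}>0$ be any constants with property (R), put $$t_*=\frac{b\gamma+1-\sqrt{(b\gamma+1)^2-8b\gamma}}{4\gamma},$$ and suppose that $$t_*\le r_{x_0},\qquad \frac{4^3\gamma b^2}{\lambda\left(3-b\gamma+\sqrt{(b\gamma+1)^2-8b\gamma}\right)^3}<r_0 .$$ Then the Newton sequence for $f(x)+F(x)\ni 0$ with starting point $x_0$, given by $$\{x_{k+1}\}=L_f(x_k,0)^{-1}\cap B(x_1,r_{x_1}),\qquad k=0,1,\ldots$$ (each of these sets being a singleton), is well defined (here the iterate $x_1$ coincides with the given point $x_1$), is contained in $B(x_0,t_*)$, and converges to a point $x_*\in B[x_0,t_*]\cap B(x_1,r_{x_1})$, which is the unique solution of $f(x)+F(x)\ni 0$ in $B[x_0,t_*]\cap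 B(x_1,r_{x_1})$. Moreover, $$\|x_*-x_{k+1}\|\le\tfrac12\|x_*-x_k\|,\qquad k=0,1,\ldots .$$ If in addition $b\gamma<3-2\sqrt2$, then $$\|x_*-x_{k+1}\|\le\frac{\gamma}{(1-\gamma t_*)\left[2(1-\gamma t_*)^2-1\right]}\,\|x_*-x_k\|^2,\qquad k=0,1,\ldots .$$ -/

import Mathlib

open Set Filter Topology Metric

/-- The value at `x` of the set-valued mapping `h + H`. -/
def generalizedSum {X Y : Type*} [AddCommGroup Y] (h : X → Y) (H : X → Set Y) (x : X) : Set Y :=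
  (fun v => h x + v) '' H x

/-- The partial linearization `L_h(x, y) = h(x) + h'(x)(y - x) + H(y)` of `h + H` at `x`. -/
def partialLinearization {X Y : Type*} [NormedAddCommGroup X] [NormedSpace ℝ X]
    [NormedAddCommGroup Y] [NormedSpace ℝ Y] (h : X → Y) (H : X → Set Y) (x y : X) : Set Y :=
  (fun v => h x + fderiv ℝ h x (y - x) + v) '' H y

/-- The inverse `L_h(x, z)⁻¹ = {y | z ∈ h(x) + h'(x)(y - x) + H(y)}`. -/
def partialLinearizationInv {X Y : Type*} [NormedAddCommGroup X] [NormedSpace ℝ X]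
    [NormedAddCommGroup Y] [NormedSpace ℝ Y] (h : X → Y) (H : X → Set Y) (x : X) (z : Y) : Set X :=
  {y | z ∈ partialLinearization h H x y}

/-- The set-valued mapping `z ↦ G z ∩ U` is single-valued from `V` to `U` (exactly one value at
each point of `V`) and Lipschitz on `V` with modulus `L`. -/
def SingleValuedLipschitz {X Y : Type*} [NormedAddCommGroup X] [NormedAddCommGroup Y]
    (G : Y → Set X) (V : Set Y) (U : Set X) (L : ℝ) : Prop :=
  (∀ z ∈ V, ∃! w, w ∈ G z ∩ U) ∧
    ∀ z ∈ V, ∀ z' ∈ V, ∀ w ∈ G z ∩ U, ∀ w' ∈ G z' ∩ U, ‖w - w'‖ ≤ L * ‖z - z'‖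

/-- `h + H`, with `h` defined on `Ω`, is strongly regular at `x` for `y` with associated Lipschitz
constant `lam`. -/
def StronglyRegular {X Y : Type*} [NormedAddCommGroup X] [NormedSpace ℝ X]
    [NormedAddCommGroup Y] [NormedSpace ℝ Y] (Ω : Set X) (h : X → Y) (H : X → Set Y)
    (x : X) (y : Y) (lam : ℝ) : Prop :=
  y ∈ generalizedSum h H x ∧ 0 < lam ∧
    ∃ rx > 0, ∃ ry > 0, ball x rx ⊆ Ω ∧
      SingleValuedLipschitz (partialLinearizationInv h H x) (ball y ry) (ball x rx) lam

/-- The radii `r_{x₁}`, `r₀`, `r_{x₀}` of stability of the partial linearization: for every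
`x ∈ B(x₀, r_{x₀})` (where `f`, being given on `Ω` only, is defined) one has
`lam ‖f'(x) - f'(x₀)‖ < 1`, and `z ↦ L_f(x, z)⁻¹ ∩ B(x₁, r_{x₁})` is single-valued from `B(0, r₀)`
to `B(x₁, r_{x₁})` and Lipschitz with modulus `lam / (1 - lam ‖f'(x) - f'(x₀)‖)`. -/
structure IsRegularityRadii {X Y : Type*} [NormedAddCommGroup X] [NormedSpace ℝ X]
    [NormedAddCommGroup Y] [NormedSpace ℝ Y] (Ω : Set X) (f : X → Y) (F : X → Set Y)
    (x₀ x₁ : X) (lam rx₁ r₀ rx₀ : ℝ) : Prop where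
  rx₁_pos : 0 < rx₁
  r₀_pos : 0 < r₀
  rx₀_pos : 0 < rx₀
  lt_one : ∀ x ∈ ball x₀ rx₀ ∩ Ω, lam * ‖fderiv ℝ f x - fderiv ℝ f x₀‖ < 1
  singleValued : ∀ x ∈ ball x₀ rx₀ ∩ Ω,
    SingleValuedLipschitz (partialLinearizationInv f F x) (ball 0 r₀) (ball x₁ rx₁)
      (lam / (1 - lam * ‖fderiv ℝ f x - fderiv ℝ f x₀‖))

/-- The numbers `‖lam f⁽ⁿ⁾(x₀) / n!‖ ^ (1 / (n - 1))`, `n > 1`. -/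
def smaleSet {X Y : Type*} [NormedAddCommGroup X] [NormedSpace ℝ X]
    [NormedAddCommGroup Y] [NormedSpace ℝ Y] (f : X → Y) (x₀ : X) (lam : ℝ) : Set ℝ :=
  {s | ∃ n : ℕ, 1 < n ∧
    s = ‖(lam / (n.factorial : ℝ)) • iteratedFDeriv ℝ n f x₀‖ ^ (1 / ((n : ℝ) - 1))}

/-- `t_* = (bγ + 1 - √((bγ + 1)² - 8bγ)) / (4γ)`. -/
noncomputable def smaleTStar (b γ : ℝ) : ℝ :=
  (b * γ + 1 - Real.sqrt ((b * γ + 1) ^ 2 - 8 * (b * γ))) / (4 * γ)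

/-! Scale distances in `X` by `γ` and residuals in `Y` by `γ * lam`, and put `β = bγ`. The
coefficient bounds give `lam ‖f''(x)‖ ≤ 2γ / (1 - γ‖x - x₀‖)³`, so `f` is majorized by the scalar
function `φ(t) = β - 2t + t/(1 - t)`, whose smaller zero is `u = γ t_*`. At scaled distance `t < u`
from `x₀` the inverse `L_f(x, ·)⁻¹` has Lipschitz modulus at most `-lam/φ'(t)`. A Newton iterate `w`
of `x` solves the linearization at `w` up to the Taylor error of `f` at `x`, so the Newton steps are
dominated by those of the scalar Newton iteration for `φ` from `0` (`norm_newton_sub_le`), whose gap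
to `u` at least halves at each step.

The Lipschitz estimate holds only for right sides in `B(0, r₀)`, and the hypothesis on `r₀` says
`β²/(1 - u)³ < γ lam r₀`. This covers steps of scaled length at most `β`, hence all iterates, but
not necessarily the residual at `x₀` of a solution `y`, which is only bounded by `u²/(1 - u)`. Two
detours result. For uniqueness, `y` is compared with `x₁` from intermediate base points: one on the
segment to `y` gives `γ‖y - x₁‖ ≤ β`, then one on the segment to `x₁` gives `≤ u - β`; after that
the distances from `y` to the iterates are bounded by the scalar gaps. For the rate of the first
step, either the residual is small enough, or `y` is so far from `x₀` that the bound `u - β`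
suffices.

The radii of property (R) come from a contraction argument (`SingleValuedLipschitz.change_base`),
and the limit is identified from the fixed base point `x₁` (`limit_mem`). -/

/-! ### Taylor coefficients and the bound on the second derivative. -/

section TaylorSeries

open FormalMultilinearSeries
open scoped ENNReal NNReal

variable {X Y : Type*} [NormedAddCommGroup X] [NormedSpace ℝ X]
  [NormedAddCommGroup Y] [NormedSpace ℝ Y]

/-- Up to currying this is the first-order change-of-origin series, whose `n`-th term is a sum over
the `n`-element subsets of `n + 1` indices. -/
theorem norm_derivSeries_le (p : FormalMultilinearSeries ℝ X Y) (n : ℕ) :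
    ‖p.derivSeries n‖ ≤ (n + 1) * ‖p (n + 1)‖ := by
  have h1 : ‖p.derivSeries n‖ ≤ ‖p.changeOriginSeries 1 n‖ := by
    refine (ContinuousLinearMap.norm_compContinuousMultilinearMap_le _ _).trans ?_
    apply mul_le_of_le_one_left (norm_nonneg _)
    exact ContinuousLinearMap.opNorm_le_bound _ zero_le_one (by simp)
  have h2 := p.nnnorm_changeOriginSeries_le_tsum 1 n
  have h3 : ‖p (1 + n)‖₊ = ‖p (n + 1)‖₊ := by rw [add_comm]
  rw [tsum_fintype, Finset.sum_const, Finset.card_univ, Fintype.card_finset_len, h3,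
    Fintype.card_fin, nsmul_eq_mul, add_comm 1 n, Nat.choose_succ_self_right] at h2
  refine h1.trans ?_
  exact_mod_cast h2

/-- The Taylor series of `f` at `x`, with the iterated derivatives as coefficients. -/
noncomputable def iteratedTaylorSeries (f : X → Y) (x : X) : FormalMultilinearSeries ℝ X Y :=
  fun n => (n.factorial : ℝ)⁻¹ • iteratedFDeriv ℝ n f x

theorem norm_iteratedTaylorSeries_le {f : X → Y} {x : X} {lam γ : ℝ} (hlam : 0 < lam)
    (hγ : γ ∈ upperBounds (smaleSet f x lam)) (n : ℕ) :
    lam * ‖iteratedTaylorSeries f x (n + 2)‖ ≤ γ ^ (n + 1) := by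
  have h := hγ ⟨n + 2, by omega, rfl⟩
  have e : ‖(lam / ((n + 2).factorial : ℝ)) • iteratedFDeriv ℝ (n + 2) f x‖
      = lam * ‖iteratedTaylorSeries f x (n + 2)‖ := by
    rw [iteratedTaylorSeries, div_eq_mul_inv, mul_smul, norm_smul, Real.norm_of_nonneg hlam.le]
  rw [e] at h
  have e2 : (((n + 2 : ℕ) : ℝ) - 1) = ((n + 1 : ℕ) : ℝ) := by push_cast; ring
  rw [e2] at h
  have h0 : 0 ≤ lam * ‖iteratedTaylorSeries f x (n + 2)‖ := by positivity
  calc lam * ‖iteratedTaylorSeries f x (n + 2)‖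
      = ((lam * ‖iteratedTaylorSeries f x (n + 2)‖) ^ (1 / ((n + 1 : ℕ) : ℝ))) ^ (n + 1) := by
        rw [one_div, Real.rpow_inv_natCast_pow h0 (by omega)]
    _ ≤ γ ^ (n + 1) := pow_le_pow_left₀ (Real.rpow_nonneg h0 _) h _

theorem le_radius_iteratedTaylorSeries {f : X → Y} {x : X} {lam γ : ℝ} (hlam : 0 < lam)
    (hγ0 : 0 < γ) (hγ : γ ∈ upperBounds (smaleSet f x lam)) :
    ENNReal.ofReal (1 / γ) ≤ (iteratedTaylorSeries f x).radius := by
  -- The orders `0` and `1` are not controlled by `γ`, so they enter the uniform bound as constants.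
  have key : ∀ n, ‖iteratedTaylorSeries f x n‖ * ((1 / γ).toNNReal : ℝ) ^ n ≤
      ‖iteratedTaylorSeries f x 0‖ + ‖iteratedTaylorSeries f x 1‖ * (1 / γ) + 1 / (lam * γ) := by
    intro n
    rw [Real.coe_toNNReal _ (by positivity)]
    rcases n with _ | _ | n
    · simp only [pow_zero, mul_one]
      have : 0 ≤ ‖iteratedTaylorSeries f x 1‖ * (1 / γ) + 1 / (lam * γ) := by positivity
      linarith
    · simp only [zero_add, pow_one]
      have : 0 ≤ ‖iteratedTaylorSeries f x 0‖ + 1 / (lam * γ) := by positivity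
      linarith
    · have h := norm_iteratedTaylorSeries_le hlam hγ n
      have : ‖iteratedTaylorSeries f x (n + 2)‖ * (1 / γ) ^ (n + 2) ≤ 1 / (lam * γ) := by
        rw [le_div_iff₀ (by positivity), one_div, inv_pow]
        calc ‖iteratedTaylorSeries f x (n + 2)‖ * (γ ^ (n + 2))⁻¹ * (lam * γ)
            = lam * ‖iteratedTaylorSeries f x (n + 2)‖ * (γ * (γ ^ (n + 2))⁻¹) := by ring
          _ ≤ γ ^ (n + 1) * (γ * (γ ^ (n + 2))⁻¹) := by gcongr
          _ = 1 := by rw [pow_succ γ (n + 1)]; field_simp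
      have h' : 0 ≤ ‖iteratedTaylorSeries f x 0‖ + ‖iteratedTaylorSeries f x 1‖ * (1 / γ) := by
        positivity
      have e : n + 1 + 1 = n + 2 := rfl
      rw [e]
      linarith
  exact (iteratedTaylorSeries f x).le_radius_of_bound _ key

/-- The coefficients of `p` need not be symmetric; only their diagonal values are determined by `f`.
-/
theorem HasFPowerSeriesOnBall.apply_diag_eq_iteratedTaylorSeries [CompleteSpace Y] {f : X → Y}
    {p : FormalMultilinearSeries ℝ X Y} {x : X} {r : ℝ≥0∞} (h : HasFPowerSeriesOnBall f p x r)
    (n : ℕ) (y : X) : p n (fun _ => y) = iteratedTaylorSeries f x n (fun _ => y) := by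
  rw [iteratedTaylorSeries, _root_.smul_apply, ← h.factorial_smul y n,
    ← Nat.cast_smul_eq_nsmul ℝ, smul_smul, inv_mul_cancel₀ (by positivity), one_smul]

/-- An analytic function agrees with its Taylor series on a ball of its domain contained in the
disc of convergence. -/
theorem hasFPowerSeriesOnBall_iteratedTaylorSeries [CompleteSpace Y] {Ω : Set X} {f : X → Y}
    (hf : AnalyticOnNhd ℝ f Ω) {x : X} {r : ℝ} (hr : 0 < r) (hball : ball x r ⊆ Ω)
    (hrad : ENNReal.ofReal r ≤ (iteratedTaylorSeries f x).radius) :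
    HasFPowerSeriesOnBall f (iteratedTaylorSeries f x) x (ENNReal.ofReal r) := by
  set q := iteratedTaylorSeries f x with hq
  have hr' : 0 < ENNReal.ofReal r := by simpa using hr
  have hs : HasFPowerSeriesOnBall (fun z => q.sum (z - x)) q x (ENNReal.ofReal r) := by
    simpa using ((q.hasFPowerSeriesOnBall (hr'.trans_le hrad)).comp_sub x).mono hr' hrad
  have hb : eball x (ENNReal.ofReal r) = ball x r := by
    rw [Metric.eball_ofReal]
  refine hs.congr fun z hz => ?_
  rw [hb] at hz
  have han : AnalyticOnNhd ℝ (fun z => q.sum (z - x)) (ball x r) := by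
    rw [← hb]; exact hs.analyticOnNhd
  -- Identity theorem: agreement near the centre is enough, and there `f` is the sum of some power
  -- series with the same diagonal values.
  refine han.eqOn_of_preconnected_of_eventuallyEq (hf.mono hball)
    (convex_ball x r).isPreconnected (mem_ball_self hr) ?_ hz
  obtain ⟨p, r', hp⟩ := hf x (hball (mem_ball_self hr))
  have hm : min r' (ENNReal.ofReal r) > 0 := lt_min hp.r_pos hr'
  filter_upwards [Metric.eball_mem_nhds x hm] with w hw
  have hw' : w - x ∈ eball (0 : X) (min r' (ENNReal.ofReal r)) := by
    simpa [edist_eq_enorm_sub] using hw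
  have h1 := hp.hasSum (y := w - x) (Metric.eball_subset_eball (min_le_left _ _) hw')
  have h2 := hs.hasSum (y := w - x) (Metric.eball_subset_eball (min_le_right _ _) hw')
  simp only [hp.apply_diag_eq_iteratedTaylorSeries] at h1
  have := h2.unique h1
  simpa using this

theorem HasFPowerSeriesOnBall.norm_le_of_hasSum {g : X → Y} {p : FormalMultilinearSeries ℝ X Y}
    {x₀ x : X} {r : ℝ≥0∞} (h : HasFPowerSeriesOnBall g p x₀ r) (hx : x ∈ eball x₀ r)
    {a : ℕ → ℝ} {A : ℝ} (ha : ∀ n, ‖p n‖ * ‖x - x₀‖ ^ n ≤ a n) (hA : HasSum a A) :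
    ‖g x‖ ≤ A := by
  have hsum := h.hasSum_sub hx
  rw [← hsum.tsum_eq]
  refine tsum_of_norm_bounded hA fun n => le_trans ?_ (ha n)
  simpa using (p n).le_opNorm (fun _ => x - x₀)

theorem norm_derivSeries_derivSeries_le (p : FormalMultilinearSeries ℝ X Y) (n : ℕ) :
    ‖p.derivSeries.derivSeries n‖ ≤ (n + 1) * ((n + 2) * ‖p (n + 2)‖) := by
  refine (norm_derivSeries_le p.derivSeries n).trans ?_
  have h2 := norm_derivSeries_le p (n + 1)
  have e : ((n + 1 : ℕ) : ℝ) + 1 = n + 2 := by push_cast; ring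
  rw [e] at h2
  exact mul_le_mul_of_nonneg_left h2 (by positivity)

/-- The coefficient bound is what two termwise differentiations produce; the sum is evaluated by `∑
C(n+2, 2) tⁿ = (1 - t)⁻³`. -/
theorem HasFPowerSeriesOnBall.norm_le_of_geometric {g : X → Y}
    {p : FormalMultilinearSeries ℝ X Y} {x₀ : X} {lam γ : ℝ} (hlam : 0 < lam) (hγ0 : 0 < γ)
    (hp : ∀ n, ‖p n‖ ≤ (n + 1) * ((n + 2) * (γ ^ (n + 1) / lam)))
    (h : HasFPowerSeriesOnBall g p x₀ (ENNReal.ofReal (1 / γ))) {x : X}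
    (hx : γ * ‖x - x₀‖ < 1) : lam * ‖g x‖ ≤ 2 * γ / (1 - γ * ‖x - x₀‖) ^ 3 := by
  have hmem : x ∈ eball x₀ (ENNReal.ofReal (1 / γ)) := by
    rw [Metric.eball_ofReal, mem_ball_iff_norm, lt_div_iff₀ hγ0]; linarith
  obtain ⟨t, ht⟩ : ∃ t, t = γ * ‖x - x₀‖ := ⟨_, rfl⟩
  rw [← ht] at hx ⊢
  have ht0 : 0 ≤ t := by rw [ht]; positivity
  have hgeo : HasSum (fun n : ℕ => 2 * γ / lam * (((n + 2).choose 2 : ℕ) * t ^ n))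
      (2 * γ / lam * (1 / (1 - t) ^ (2 + 1))) := by
    have ht1 : ‖t‖ < 1 := by rwa [Real.norm_of_nonneg ht0]
    have := hasSum_choose_mul_geometric_of_norm_lt_one 2 ht1
    exact this.mul_left _
  have hterm : ∀ n, ‖p n‖ * ‖x - x₀‖ ^ n ≤
      2 * γ / lam * (((n + 2).choose 2 : ℕ) * t ^ n) := by
    intro n
    have hch : (((n + 2).choose 2 : ℕ) : ℝ) = (n + 1) * (n + 2) / 2 := by
      rw [Nat.cast_choose_two]; push_cast; ring
    calc _ ≤ ((n + 1) * ((n + 2) * (γ ^ (n + 1) / lam))) * ‖x - x₀‖ ^ n :=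
          mul_le_mul_of_nonneg_right (hp n) (by positivity)
      _ = _ := by
          rw [hch, ht, mul_pow, pow_succ γ n]; field_simp
  have := h.norm_le_of_hasSum hmem hterm hgeo
  have h1 : 0 < 1 - t := by linarith
  calc lam * ‖g x‖ ≤ lam * (2 * γ / lam * (1 / (1 - t) ^ (2 + 1))) := by
        gcongr
    _ = _ := by field_simp

theorem norm_fderiv_fderiv_le [CompleteSpace Y] {f : X → Y} {x₀ : X} {lam γ : ℝ}
    (hlam : 0 < lam) (hγ0 : 0 < γ)
    (hcoef : ∀ n, lam * ‖iteratedTaylorSeries f x₀ (n + 2)‖ ≤ γ ^ (n + 1))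
    (hf : HasFPowerSeriesOnBall f (iteratedTaylorSeries f x₀) x₀ (ENNReal.ofReal (1 / γ)))
    {x : X} (hx : γ * ‖x - x₀‖ < 1) :
    lam * ‖fderiv ℝ (fderiv ℝ f) x‖ ≤ 2 * γ / (1 - γ * ‖x - x₀‖) ^ 3 := by
  refine HasFPowerSeriesOnBall.norm_le_of_geometric hlam hγ0 (fun n => ?_) hf.fderiv.fderiv hx
  refine (norm_derivSeries_derivSeries_le _ n).trans ?_
  have h3 := hcoef n
  have h4 : ‖iteratedTaylorSeries f x₀ (n + 2)‖ ≤ γ ^ (n + 1) / lam := by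
    rw [le_div_iff₀ hlam]; linarith
  exact mul_le_mul_of_nonneg_left (mul_le_mul_of_nonneg_left h4 (by positivity)) (by positivity)

end TaylorSeries

/-! ### The scalar majorant, integrated along segments. -/

section Majorant

variable {X Y : Type*} [NormedAddCommGroup X] [NormedSpace ℝ X]
  [NormedAddCommGroup Y] [NormedSpace ℝ Y]

/-- `f` is analytic on the ball of radius `1 / γ`, where its second derivative is dominated by that
of the scalar function `t ↦ γ t² / (1 - γ t)`. -/
structure SmaleMajorant (f : X → Y) (x₀ : X) (lam γ : ℝ) : Prop where
  lam_pos : 0 < lam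
  γ_pos : 0 < γ
  analyticAt : ∀ x, γ * ‖x - x₀‖ < 1 → AnalyticAt ℝ f x
  bound : ∀ x, γ * ‖x - x₀‖ < 1 →
    lam * ‖fderiv ℝ (fderiv ℝ f) x‖ ≤ 2 * γ / (1 - γ * ‖x - x₀‖) ^ 3

theorem smaleMajorant_of_analyticOnNhd [CompleteSpace Y] {Ω : Set X} {f : X → Y}
    (hf : AnalyticOnNhd ℝ f Ω) {x₀ : X} {lam γ : ℝ} (hlam : 0 < lam) (hγ0 : 0 < γ)
    (hγ : γ ∈ upperBounds (smaleSet f x₀ lam)) (hball : ball x₀ (1 / γ) ⊆ Ω) :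
    SmaleMajorant f x₀ lam γ where
  lam_pos := hlam
  γ_pos := hγ0
  analyticAt x hx := hf x (hball (by
    rw [mem_ball_iff_norm, lt_div_iff₀ hγ0]; linarith))
  bound _ := norm_fderiv_fderiv_le hlam hγ0 (norm_iteratedTaylorSeries_le hlam hγ)
    (hasFPowerSeriesOnBall_iteratedTaylorSeries hf (by positivity) hball
      (le_radius_iteratedTaylorSeries hlam hγ0 hγ))

namespace SmaleMajorant

variable {f : X → Y} {x₀ : X} {lam γ : ℝ}

theorem norm_segment_le (hγ0 : 0 < γ) {x y : X} {S T : ℝ} (hx : γ * ‖x - x₀‖ ≤ S)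
    (hy : γ * ‖y - x₀‖ ≤ T) {θ : ℝ} (hθ : θ ∈ Icc (0 : ℝ) 1) :
    γ * ‖x + θ • (y - x) - x₀‖ ≤ (1 - θ) * S + θ * T := by
  have e : x + θ • (y - x) - x₀ = (1 - θ) • (x - x₀) + θ • (y - x₀) := by module
  have h1 : 0 ≤ 1 - θ := by linarith [hθ.2]
  calc γ * ‖x + θ • (y - x) - x₀‖ ≤ γ * ((1 - θ) * ‖x - x₀‖ + θ * ‖y - x₀‖) := by
        rw [e]
        refine mul_le_mul_of_nonneg_left ((norm_add_le _ _).trans (le_of_eq ?_)) hγ0.le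
        rw [norm_smul, norm_smul, Real.norm_of_nonneg h1, Real.norm_of_nonneg hθ.1]
    _ = (1 - θ) * (γ * ‖x - x₀‖) + θ * (γ * ‖y - x₀‖) := by ring
    _ ≤ _ := add_le_add (mul_le_mul_of_nonneg_left hx h1) (mul_le_mul_of_nonneg_left hy hθ.1)

/-- This is the affine interpolation between `1 - S` and `1 - T`, so no order between `S` and `T` is
needed. -/
theorem one_sub_sub_mul_pos {S T : ℝ} (hS : S < 1) (hT : T < 1) {θ : ℝ}
    (hθ : θ ∈ Icc (0 : ℝ) 1) : 0 < 1 - S - (T - S) * θ := by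
  rcases le_total T S with h | h
  · nlinarith [hθ.1]
  · nlinarith [hθ.2]

theorem hasDerivAt_segment (x y : X) (θ : ℝ) :
    HasDerivAt (fun θ : ℝ => x + θ • (y - x)) (y - x) θ := by
  simpa using ((hasDerivAt_id θ).smul_const (y - x)).const_add x

/-- Integrates `2γ‖y - x‖ / (1 - S - (T - S)τ)³` over `[0, θ]`. The factor `T - S` is cancelled from
the primitive, so `S = T` needs no separate case. -/
theorem norm_fderiv_segment_sub_le [CompleteSpace Y] (h : SmaleMajorant f x₀ lam γ) {x y : X}
    {S T : ℝ} (hx : γ * ‖x - x₀‖ ≤ S) (hS : S < 1) (hy : γ * ‖y - x₀‖ ≤ T) (hT : T < 1)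
    {θ : ℝ} (hθ : θ ∈ Icc (0 : ℝ) 1) :
    lam * ‖fderiv ℝ f (x + θ • (y - x)) - fderiv ℝ f x‖ ≤
      γ * ‖y - x‖ * (θ * (2 * (1 - S) - (T - S) * θ) /
        ((1 - S) ^ 2 * (1 - S - (T - S) * θ) ^ 2)) := by
  have hγ0 := h.γ_pos
  have hlam := h.lam_pos
  have hpos : ∀ τ ∈ Icc (0 : ℝ) 1, 0 < 1 - S - (T - S) * τ := fun τ hτ =>
    one_sub_sub_mul_pos hS hT hτ
  have hseg : ∀ τ ∈ Icc (0 : ℝ) 1, γ * ‖x + τ • (y - x) - x₀‖ ≤ 1 - (1 - S - (T - S) * τ) :=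
    fun τ hτ => (norm_segment_le hγ0 hx hy hτ).trans_eq (by ring)
  have hlt : ∀ τ ∈ Icc (0 : ℝ) 1, γ * ‖x + τ • (y - x) - x₀‖ < 1 := fun τ hτ => by
    linarith [hseg τ hτ, hpos τ hτ]
  have hder : ∀ τ ∈ Icc (0 : ℝ) 1,
      HasDerivAt (fun τ : ℝ => lam • (fderiv ℝ f (x + τ • (y - x)) - fderiv ℝ f x))
        (lam • fderiv ℝ (fderiv ℝ f) (x + τ • (y - x)) (y - x)) τ := fun τ hτ => by
    have h1 := (h.analyticAt _ (hlt τ hτ)).fderiv.differentiableAt.hasFDerivAt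
    exact ((h1.comp_hasDerivAt τ (hasDerivAt_segment x y τ)).sub_const _).const_smul lam
  have hB : ∀ τ ∈ Icc (0 : ℝ) 1,
      HasDerivAt (fun θ : ℝ => γ * ‖y - x‖ * (θ * (2 * (1 - S) - (T - S) * θ) /
        ((1 - S) ^ 2 * (1 - S - (T - S) * θ) ^ 2)))
        (2 * γ / (1 - S - (T - S) * τ) ^ 3 * ‖y - x‖) τ := fun τ hτ => by
    have hp := hpos τ hτ
    have hS' : (0 : ℝ) < 1 - S := by linarith
    have hl : HasDerivAt (fun θ : ℝ => (T - S) * θ) (T - S) τ := by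
      simpa using (hasDerivAt_id τ).const_mul (T - S)
    have h1 := (hasDerivAt_id τ).mul (hl.const_sub (2 * (1 - S)))
    have h2 := ((hl.const_sub (1 - S)).pow 2).const_mul ((1 - S) ^ 2)
    have h3 := (h1.div h2 (by simp only [Pi.pow_apply]; positivity)).const_mul (γ * ‖y - x‖)
    refine h3.congr_deriv ?_
    simp only [Pi.pow_apply, Pi.mul_apply, id]
    field_simp
    ring
  have := image_norm_le_of_norm_deriv_right_le_deriv_boundary' (a := 0) (b := 1)
    (fun τ hτ => (hder τ hτ).continuousAt.continuousWithinAt)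
    (fun τ hτ => (hder τ (Ico_subset_Icc_self hτ)).hasDerivWithinAt) (by simp)
    (fun τ hτ => (hB τ hτ).continuousAt.continuousWithinAt)
    (fun τ hτ => (hB τ (Ico_subset_Icc_self hτ)).hasDerivWithinAt)
    (fun τ hτ => ?_) hθ
  · rwa [norm_smul, Real.norm_of_nonneg hlam.le] at this
  · have hτ := Ico_subset_Icc_self hτ
    have hp := hpos τ hτ
    rw [norm_smul, Real.norm_of_nonneg hlam.le]
    calc lam * ‖fderiv ℝ (fderiv ℝ f) (x + τ • (y - x)) (y - x)‖
        ≤ lam * (‖fderiv ℝ (fderiv ℝ f) (x + τ • (y - x))‖ * ‖y - x‖) := by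
          gcongr; exact ContinuousLinearMap.le_opNorm _ _
      _ = lam * ‖fderiv ℝ (fderiv ℝ f) (x + τ • (y - x))‖ * ‖y - x‖ := by ring
      _ ≤ 2 * γ / (1 - S - (T - S) * τ) ^ 3 * ‖y - x‖ := by
          refine mul_le_mul_of_nonneg_right ((h.bound _ (hlt τ hτ)).trans ?_) (norm_nonneg _)
          refine div_le_div_of_nonneg_left (by positivity) (by positivity)
            (pow_le_pow_left₀ hp.le ?_ 3)
          linarith [hseg τ hτ]

/-- The error of the first-order Taylor expansion of `f` at `x`. -/
theorem norm_sub_linearization_le [CompleteSpace Y] (h : SmaleMajorant f x₀ lam γ) {x y : X}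
    {S T : ℝ} (hx : γ * ‖x - x₀‖ ≤ S) (hS : S < 1) (hy : γ * ‖y - x₀‖ ≤ T) (hT : T < 1) :
    γ * (lam * ‖f y - (f x + fderiv ℝ f x (y - x))‖) ≤
      (γ * ‖y - x‖) ^ 2 / ((1 - S) ^ 2 * (1 - T)) := by
  have hγ0 := h.γ_pos
  have hlam := h.lam_pos
  have hpos : ∀ τ ∈ Icc (0 : ℝ) 1, 0 < 1 - S - (T - S) * τ := fun τ hτ =>
    one_sub_sub_mul_pos hS hT hτ
  have hlt : ∀ τ ∈ Icc (0 : ℝ) 1, γ * ‖x + τ • (y - x) - x₀‖ < 1 := fun τ hτ => by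
    have : γ * ‖x + τ • (y - x) - x₀‖ ≤ 1 - (1 - S - (T - S) * τ) :=
      (norm_segment_le hγ0 hx hy hτ).trans_eq (by ring)
    linarith [hpos τ hτ]
  have hder : ∀ τ ∈ Icc (0 : ℝ) 1,
      HasDerivAt (fun τ : ℝ => lam • (f (x + τ • (y - x)) - (f x + τ • fderiv ℝ f x (y - x))))
        (lam • (fderiv ℝ f (x + τ • (y - x)) - fderiv ℝ f x) (y - x)) τ := fun τ hτ => by
    have h1 := (h.analyticAt _ (hlt τ hτ)).differentiableAt.hasFDerivAt
    have h2 := h1.comp_hasDerivAt τ (hasDerivAt_segment x y τ)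
    have h3 : HasDerivAt (fun τ : ℝ => f x + τ • fderiv ℝ f x (y - x))
        (fderiv ℝ f x (y - x)) τ := by
      simpa using ((hasDerivAt_id τ).smul_const (fderiv ℝ f x (y - x))).const_add (f x)
    exact (h2.sub h3).const_smul lam
  -- Primitive of the bound in `norm_fderiv_segment_sub_le`. At `θ = 1` its denominator becomes `(1
  -- - S)²(1 - T)`, as in the exact Taylor error of `φ`.
  have hB : ∀ τ ∈ Icc (0 : ℝ) 1,
      HasDerivAt (fun θ : ℝ => γ * ‖y - x‖ ^ 2 * (θ ^ 2 /
        ((1 - S) ^ 2 * (1 - S - (T - S) * θ))))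
        (γ * ‖y - x‖ * (τ * (2 * (1 - S) - (T - S) * τ) /
        ((1 - S) ^ 2 * (1 - S - (T - S) * τ) ^ 2)) * ‖y - x‖) τ := fun τ hτ => by
    have hp := hpos τ hτ
    have hS' : (0 : ℝ) < 1 - S := by linarith
    have hl : HasDerivAt (fun θ : ℝ => (T - S) * θ) (T - S) τ := by
      simpa using (hasDerivAt_id τ).const_mul (T - S)
    have h1 := (hasDerivAt_id τ).pow 2
    have h2 := (hl.const_sub (1 - S)).const_mul ((1 - S) ^ 2)
    have h3 := (h1.div h2 (by positivity)).const_mul (γ * ‖y - x‖ ^ 2)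
    refine h3.congr_deriv ?_
    simp only [Pi.pow_apply, id]
    field_simp
    ring
  have := image_norm_le_of_norm_deriv_right_le_deriv_boundary' (a := 0) (b := 1)
    (fun τ hτ => (hder τ hτ).continuousAt.continuousWithinAt)
    (fun τ hτ => (hder τ (Ico_subset_Icc_self hτ)).hasDerivWithinAt) (by simp)
    (fun τ hτ => (hB τ hτ).continuousAt.continuousWithinAt)
    (fun τ hτ => (hB τ (Ico_subset_Icc_self hτ)).hasDerivWithinAt)
    (fun τ hτ => ?_) (right_mem_Icc.2 zero_le_one)
  · rw [norm_smul, Real.norm_of_nonneg hlam.le, one_smul, one_smul, add_sub_cancel] at this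
    calc _ ≤ γ * (γ * ‖y - x‖ ^ 2 * (1 ^ 2 / ((1 - S) ^ 2 * (1 - S - (T - S) * 1)))) :=
          mul_le_mul_of_nonneg_left this hγ0.le
      _ = _ := by
          rw [show 1 - S - (T - S) * 1 = 1 - T by ring]; ring
  · have hτ := Ico_subset_Icc_self hτ
    rw [norm_smul, Real.norm_of_nonneg hlam.le]
    calc lam * ‖(fderiv ℝ f (x + τ • (y - x)) - fderiv ℝ f x) (y - x)‖
        ≤ lam * (‖fderiv ℝ f (x + τ • (y - x)) - fderiv ℝ f x‖ * ‖y - x‖) := by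
          gcongr; exact ContinuousLinearMap.le_opNorm _ _
      _ = lam * ‖fderiv ℝ f (x + τ • (y - x)) - fderiv ℝ f x‖ * ‖y - x‖ := by ring
      _ ≤ _ := mul_le_mul_of_nonneg_right
          (h.norm_fderiv_segment_sub_le hx hS hy hT hτ) (norm_nonneg _)

/-- The right side is `φ'(S) - φ'(0)`. -/
theorem norm_fderiv_sub_le [CompleteSpace Y] (h : SmaleMajorant f x₀ lam γ) {x : X} {S : ℝ}
    (hx : γ * ‖x - x₀‖ ≤ S) (hS : S < 1) :
    lam * ‖fderiv ℝ f x - fderiv ℝ f x₀‖ ≤ 1 / (1 - S) ^ 2 - 1 := by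
  have h0 : γ * ‖x₀ - x₀‖ ≤ 0 := by simp
  have hS0 : 0 ≤ S := le_trans (mul_nonneg h.γ_pos.le (norm_nonneg _)) hx
  have := h.norm_fderiv_segment_sub_le h0 one_pos hx hS (right_mem_Icc.2 zero_le_one)
  have hS' : (0 : ℝ) < 1 - S := by linarith
  rw [one_smul, add_sub_cancel] at this
  calc _ ≤ _ := this
    _ ≤ S * (1 * (2 * (1 - 0) - (S - 0) * 1) / ((1 - 0) ^ 2 * (1 - 0 - (S - 0) * 1) ^ 2)) := by
        refine mul_le_mul_of_nonneg_right hx (div_nonneg ?_ (by positivity))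
        linarith
    _ = _ := by
        simp only [sub_zero, mul_one]
        field_simp
        ring

end SmaleMajorant

end Majorant

/-! ### Strong regularity under a change of base point. -/

section Radii

theorem zero_mem_generalizedSum {X Y : Type*} [AddCommGroup Y] {f : X → Y} {F : X → Set Y} {x : X} :
    (0 : Y) ∈ generalizedSum f F x ↔ -f x ∈ F x := by
  simp only [generalizedSum, mem_image]
  constructor
  · rintro ⟨v, hv, h⟩
    rwa [eq_neg_of_add_eq_zero_right h] at hv
  · intro h
    exact ⟨_, h, by abel⟩

variable {X Y : Type*} [NormedAddCommGroup X] [NormedSpace ℝ X]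
  [NormedAddCommGroup Y] [NormedSpace ℝ Y]

theorem mem_partialLinearizationInv {f : X → Y} {F : X → Set Y} {x y : X} {z : Y} :
    y ∈ partialLinearizationInv f F x z ↔ z - (f x + fderiv ℝ f x (y - x)) ∈ F y := by
  simp only [partialLinearizationInv, partialLinearization, mem_ofPred_eq, mem_image]
  constructor
  · rintro ⟨v, hv, rfl⟩
    simpa using hv
  · intro h
    exact ⟨_, h, by abel⟩

/-- The point `y` belongs to the linearization at `x'` once it belongs to the one at `x`, up to the
difference of the two affine maps at `y`. -/
theorem mem_partialLinearizationInv_change {f : X → Y} {F : X → Set Y} {x x' y : X} {z : Y}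
    (h : y ∈ partialLinearizationInv f F x z) :
    y ∈ partialLinearizationInv f F x'
      (z + (f x' + fderiv ℝ f x' (y - x')) - (f x + fderiv ℝ f x (y - x))) := by
  rw [mem_partialLinearizationInv] at h ⊢
  convert h using 1
  abel

theorem mem_partialLinearizationInv_of_solution {f : X → Y} {F : X → Set Y} {y : X}
    (h : (0 : Y) ∈ generalizedSum f F y) (x : X) :
    y ∈ partialLinearizationInv f F x (f x + fderiv ℝ f x (y - x) - f y) := by
  rw [zero_mem_generalizedSum] at h
  rw [mem_partialLinearizationInv]
  convert h using 1
  abel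

theorem solution_of_mem_partialLinearizationInv {f : X → Y} {F : X → Set Y} {x y : X}
    (h : y ∈ partialLinearizationInv f F x (f x + fderiv ℝ f x (y - x) - f y)) :
    (0 : Y) ∈ generalizedSum f F y := by
  rw [mem_partialLinearizationInv] at h
  rw [zero_mem_generalizedSum]
  convert h using 1
  abel

/-- An affine map is its own linearization at every point; this turns the regularity hypothesis into
one on `L_f(x₀, ·)`. -/
theorem partialLinearizationInv_linearization (f : X → Y) (F : X → Set Y) (x₀ x₁ : X) (z : Y) :
    partialLinearizationInv (fun x => f x₀ + fderiv ℝ f x₀ (x - x₀)) F x₁ z =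
      partialLinearizationInv f F x₀ z := by
  have hd : fderiv ℝ (fun x => f x₀ + fderiv ℝ f x₀ (x - x₀)) x₁ = fderiv ℝ f x₀ := by
    have h1 : HasFDerivAt (fun x => x - x₀) (ContinuousLinearMap.id ℝ X) x₁ :=
      (hasFDerivAt_id x₁).sub_const x₀
    simpa using (((fderiv ℝ f x₀).hasFDerivAt.comp x₁ h1).const_add (f x₀)).fderiv
  ext y
  rw [mem_partialLinearizationInv, mem_partialLinearizationInv, hd]
  have e : y - x₀ = (x₁ - x₀) + (y - x₁) := by abel
  rw [e, map_add]
  simp only [add_assoc]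

theorem StronglyRegular.mem_and_singleValuedLipschitz {f : X → Y} {F : X → Set Y} {x₀ x₁ : X}
    {lam : ℝ}
    (hreg : StronglyRegular univ (fun x => f x₀ + fderiv ℝ f x₀ (x - x₀)) F x₁ 0 lam) :
    x₁ ∈ partialLinearizationInv f F x₀ 0 ∧ 0 < lam ∧ ∃ rx > 0, ∃ ry > 0,
      SingleValuedLipschitz (partialLinearizationInv f F x₀) (ball 0 ry) (ball x₁ rx) lam := by
  obtain ⟨h0, hlam, rx, hrx, ry, hry, -, hs⟩ := hreg
  refine ⟨?_, hlam, rx, hrx, ry, hry, ?_⟩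
  · rw [zero_mem_generalizedSum] at h0
    rw [mem_partialLinearizationInv, zero_sub]
    exact h0
  · have : partialLinearizationInv (fun x => f x₀ + fderiv ℝ f x₀ (x - x₀)) F x₁ =
        partialLinearizationInv f F x₀ :=
      funext fun z => partialLinearizationInv_linearization f F x₀ x₁ z
    rwa [this] at hs

/-- Strong regularity of the linearization at `x₀` persists at `x` under smallness conditions on
the change of the affine map. -/
theorem SingleValuedLipschitz.change_base [CompleteSpace X] {f : X → Y} {F : X → Set Y}
    {x₀ x₁ x : X} {lam a rx ry r : ℝ} (hlam : 0 < lam) (ha : 0 < a) (harx : a < rx)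
    (hr : 0 < r) (hrry : 2 * r ≤ ry) (hra : lam * (2 * r) < a)
    (h₁ : x₁ ∈ partialLinearizationInv f F x₀ 0)
    (hs : SingleValuedLipschitz (partialLinearizationInv f F x₀) (ball 0 ry) (ball x₁ rx) lam)
    (hx : ‖f x + fderiv ℝ f x (x₁ - x) - (f x₀ + fderiv ℝ f x₀ (x₁ - x₀))‖ < r / 2)
    (hA : ‖fderiv ℝ f x - fderiv ℝ f x₀‖ * a < r / 2)
    (hA1 : lam * ‖fderiv ℝ f x - fderiv ℝ f x₀‖ < 1) :
    SingleValuedLipschitz (partialLinearizationInv f F x) (ball 0 r) (ball x₁ a)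
      (lam / (1 - lam * ‖fderiv ℝ f x - fderiv ℝ f x₀‖)) := by
  set A := fderiv ℝ f x - fderiv ℝ f x₀ with hAdef
  -- Solving the linearization at `x` for `z` means solving the one at `x₀` for `z + Δ w`, a
  -- fixed-point problem in `w`.
  set Δ : X → Y := fun w => (f x₀ + fderiv ℝ f x₀ (w - x₀)) - (f x + fderiv ℝ f x (w - x)) with hΔ
  have hΔsub : ∀ w w', Δ w - Δ w' = -A (w - w') := fun w w' => by
    simp only [hΔ, hAdef, _root_.sub_apply, map_sub]
    abel
  have hΔlip : ∀ w w', ‖Δ w - Δ w'‖ ≤ ‖A‖ * ‖w - w'‖ := fun w w' => by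
    rw [hΔsub, norm_neg]; exact A.le_opNorm _
  have hΔx₁ : ‖Δ x₁‖ < r / 2 := by rwa [norm_sub_rev] at hx
  have hΔr : ∀ w ∈ closedBall x₁ a, ‖Δ w‖ < r := fun w hw => by
    rw [mem_closedBall_iff_norm] at hw
    calc ‖Δ w‖ ≤ ‖Δ x₁‖ + ‖Δ w - Δ x₁‖ := norm_le_insert' _ _
      _ ≤ ‖Δ x₁‖ + ‖A‖ * a := by
        gcongr; exact (hΔlip _ _).trans (by gcongr)
      _ < r := by linarith
  have hmem : ∀ w ∈ closedBall x₁ a, ∀ z ∈ ball (0 : Y) r, z + Δ w ∈ ball (0 : Y) ry := by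
    intro w hw z hz
    rw [mem_ball_zero_iff] at hz ⊢
    linarith [norm_add_le z (Δ w), hΔr w hw]
  have hball : ∀ w ∈ closedBall x₁ a, w ∈ ball x₁ rx := fun w hw =>
    closedBall_subset_ball harx hw
  have hchange : ∀ w z, w ∈ partialLinearizationInv f F x z ↔
      w ∈ partialLinearizationInv f F x₀ (z + Δ w) := fun w z => by
    rw [mem_partialLinearizationInv, mem_partialLinearizationInv]
    have e : z + Δ w - (f x₀ + fderiv ℝ f x₀ (w - x₀)) = z - (f x + fderiv ℝ f x (w - x)) := by
      simp only [hΔ]; abel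
    rw [e]
  have hlip : ∀ z ∈ ball (0 : Y) r, ∀ z' ∈ ball (0 : Y) r,
      ∀ w ∈ partialLinearizationInv f F x z ∩ ball x₁ a,
      ∀ w' ∈ partialLinearizationInv f F x z' ∩ ball x₁ a,
      ‖w - w'‖ ≤ lam / (1 - lam * ‖A‖) * ‖z - z'‖ := by
    intro z hz z' hz' w hw w' hw'
    have hwc := ball_subset_closedBall hw.2
    have hwc' := ball_subset_closedBall hw'.2
    have h := hs.2 _ (hmem w hwc z hz) _ (hmem w' hwc' z' hz') w
      ⟨(hchange _ _).1 hw.1, hball w hwc⟩ w' ⟨(hchange _ _).1 hw'.1, hball w' hwc'⟩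
    -- The term `lam * ‖A‖ * ‖w - w'‖` is absorbed on the left, which produces the new modulus.
    rw [div_mul_eq_mul_div, le_div_iff₀ (by linarith)]
    have e : z + Δ w - (z' + Δ w') = (z - z') + (Δ w - Δ w') := by abel
    rw [e] at h
    have h2 : lam * ‖(z - z') + (Δ w - Δ w')‖ ≤ lam * (‖z - z'‖ + ‖A‖ * ‖w - w'‖) := by
      gcongr; exact (norm_add_le _ _).trans (by gcongr; exact hΔlip _ _)
    linarith
  refine ⟨fun z hz => ?_, hlip⟩
  have hG : ∀ v : Y, ∃ w, v ∈ ball (0 : Y) ry →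
      w ∈ partialLinearizationInv f F x₀ v ∩ ball x₁ rx := fun v => by
    by_cases hv : v ∈ ball (0 : Y) ry
    · exact ⟨_, fun _ => (hs.1 v hv).exists.choose_spec⟩
    · exact ⟨x₁, fun h => absurd h hv⟩
  choose G hG using hG
  set Φ : X → X := fun w => G (z + Δ w) with hΦ
  have hΦball : ∀ w ∈ closedBall x₁ a, Φ w ∈ ball x₁ a := fun w hw => by
    have hv := hmem w hw z hz
    have h := hs.2 _ hv 0 (mem_ball_self (by linarith)) _ (hG _ hv) x₁
      ⟨h₁, mem_ball_self (ha.trans harx)⟩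
    rw [mem_ball_iff_norm]
    rw [mem_ball_zero_iff] at hz
    rw [sub_zero] at h
    refine h.trans_lt (lt_of_le_of_lt ?_ hra)
    gcongr
    linarith [norm_add_le z (Δ w), hΔr w hw]
  have hmaps : MapsTo Φ (closedBall x₁ a) (closedBall x₁ a) := fun w hw =>
    ball_subset_closedBall (hΦball w hw)
  have hcontr : ContractingWith (lam * ‖A‖).toNNReal (hmaps.restrict Φ _ _) := by
    refine ⟨by rw [← NNReal.coe_lt_coe, Real.coe_toNNReal _ (by positivity)]; simpa using hA1,
      LipschitzWith.of_dist_le_mul fun w w' => ?_⟩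
    rw [Real.coe_toNNReal _ (by positivity), Subtype.dist_eq, Subtype.dist_eq, dist_eq_norm,
      dist_eq_norm, MapsTo.val_restrict_apply, MapsTo.val_restrict_apply]
    have hv := hmem w w.2 z hz
    have hv' := hmem w' w'.2 z hz
    refine (hs.2 _ hv _ hv' _ (hG _ hv) _ (hG _ hv')).trans ?_
    rw [add_sub_add_left_eq_sub, mul_assoc]
    gcongr
    exact hΔlip _ _
  obtain ⟨w, hw, hfix, -⟩ := ContractingWith.exists_fixedPoint' isClosed_closedBall.isComplete
    hmaps hcontr (mem_closedBall_self ha.le) (edist_ne_top _ _)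
  have hwin : w ∈ partialLinearizationInv f F x z ∩ ball x₁ a := by
    refine ⟨(hchange _ _).2 ?_, ?_⟩
    · have := (hG _ (hmem w hw z hz)).1
      rwa [show G (z + Δ w) = w from hfix] at this
    · have := hΦball w hw
      rwa [show Φ w = w from hfix] at this
  refine ⟨w, hwin, fun w' hw' => ?_⟩
  have := hlip z hz z hz w' hw' w hwin
  rw [sub_self, norm_zero, mul_zero] at this
  exact sub_eq_zero.1 (norm_le_zero_iff.1 this)

theorem exists_isRegularityRadii [CompleteSpace X] [CompleteSpace Y] {Ω : Set X} {f : X → Y}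
    {F : X → Set Y} {x₀ x₁ : X} {lam : ℝ} (hf : AnalyticAt ℝ f x₀)
    (hreg : StronglyRegular univ (fun x => f x₀ + fderiv ℝ f x₀ (x - x₀)) F x₁ 0 lam) :
    ∃ rx₁ r₀ rx₀ : ℝ, IsRegularityRadii Ω f F x₀ x₁ lam rx₁ r₀ rx₀ := by
  obtain ⟨h₁, hlam, rx, hrx, ry, hry, hs⟩ := hreg.mem_and_singleValuedLipschitz
  -- `a < rx` fits the closed ball into the given open one, `r ≤ ry / 2` leaves room for `z + Δ w`,
  -- and `r ≤ a / (4 * lam)` keeps the fixed-point map strictly inside `ball x₁ a`.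
  obtain ⟨a, ha⟩ : ∃ a, a = rx / 2 := ⟨_, rfl⟩
  obtain ⟨r, hr⟩ : ∃ r, r = min (ry / 2) (a / (4 * lam)) := ⟨_, rfl⟩
  have ha0 : 0 < a := by rw [ha]; positivity
  have hr0 : 0 < r := by rw [hr]; positivity
  have hr1 : 2 * r ≤ ry := by linarith [min_le_left (ry / 2) (a / (4 * lam))]
  have hr2 : lam * (2 * r) < a := by
    have : r ≤ a / (4 * lam) := hr ▸ min_le_right _ _
    rw [le_div_iff₀ (by positivity)] at this
    nlinarith
  have hfc : ContinuousAt f x₀ := hf.continuousAt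
  have hdc : ContinuousAt (fderiv ℝ f) x₀ := hf.fderiv.continuousAt
  have c1 : ContinuousAt
      (fun x => ‖f x + fderiv ℝ f x (x₁ - x) - (f x₀ + fderiv ℝ f x₀ (x₁ - x₀))‖) x₀ := by
    fun_prop
  have c2 : ContinuousAt (fun x => ‖fderiv ℝ f x - fderiv ℝ f x₀‖ * a) x₀ := by fun_prop
  have c3 : ContinuousAt (fun x => lam * ‖fderiv ℝ f x - fderiv ℝ f x₀‖) x₀ := by fun_prop
  have e1 := c1.eventually_lt_const (u := r / 2) (by simpa using hr0)
  have e2 := c2.eventually_lt_const (u := r / 2) (by simpa using hr0)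
  have e3 := c3.eventually_lt_const (u := 1) (by simp)
  obtain ⟨ε, hε, hall⟩ := Metric.eventually_nhds_iff_ball.1 (e1.and (e2.and e3))
  refine ⟨a, r, ε, ha0, hr0, hε, fun x hx => (hall x hx.1).2.2, fun x hx => ?_⟩
  obtain ⟨h1, h2, h3⟩ := hall x hx.1
  exact SingleValuedLipschitz.change_base hlam ha0 (by linarith) hr0 hr1 hr2 h₁ hs h1 h2 h3

end Radii

/-! ### The scalar Newton iteration and its numerical inequalities. -/

section Scalar

/-- The normalized parameters: `β = b γ` and `u = γ t_*`, the smaller root of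
`2 u² - (1 + β) u + β`. -/
structure SmaleParameters (u β : ℝ) : Prop where
  u_pos : 0 < u
  u_lt_one : u < 1
  eq : β * (1 - u) = u * (1 - 2 * u)
  nonneg : 0 ≤ 2 * (1 - u) ^ 2 - 1

/-- One Newton step for the scalar function `t ↦ β - 2 t + t / (1 - t)` with smaller zero `u`. -/
noncomputable def scalarNewtonStep (u t : ℝ) : ℝ :=
  u - (u - t) ^ 2 / ((1 - u) * (2 * (1 - t) ^ 2 - 1))

/-- Bound for the change of the linearization when the base point moves from `x₀` to a point at
normalized distance `s`, evaluated at a point at normalized distance `d` from the new base point. -/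
noncomputable def baseChangeBound (s d : ℝ) : ℝ :=
  s ^ 2 / (1 - s) + (1 / (1 - s) ^ 2 - 1) * d

namespace SmaleParameters

variable {u β : ℝ}

/-- `nonneg` means `u ≤ 1 - √2/2 ≈ 0.29289`. -/
theorem u_lt (h : SmaleParameters u β) : u < 293 / 1000 := by
  nlinarith [h.nonneg, h.u_lt_one]

theorem one_sub_u_pos (h : SmaleParameters u β) : 0 < 1 - u := by linarith [h.u_lt_one]

theorem β_eq (h : SmaleParameters u β) : β = u * (1 - 2 * u) / (1 - u) := by
  rw [eq_div_iff h.one_sub_u_pos.ne', h.eq]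

theorem β_pos (h : SmaleParameters u β) : 0 < β := by
  rw [h.β_eq]
  have := h.u_lt
  exact div_pos (mul_pos h.u_pos (by linarith)) h.one_sub_u_pos

/-- The sharp bound is `3 - 2√2 ≈ 0.17157`. -/
theorem β_lt (h : SmaleParameters u β) : β < 43 / 250 := by
  rw [h.β_eq, div_lt_iff₀ h.one_sub_u_pos]
  nlinarith [sq_nonneg (u - 293 / 1000)]

theorem u_sub_β (h : SmaleParameters u β) : u - β = u ^ 2 / (1 - u) := by
  have := h.one_sub_u_pos
  rw [h.β_eq]; field_simp; ring

theorem β_lt_u (h : SmaleParameters u β) : β < u := by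
  have := h.one_sub_u_pos
  have h2 := h.u_pos
  have : 0 < u - β := by rw [h.u_sub_β]; positivity
  linarith

theorem u_sub_β_le (h : SmaleParameters u β) : u - β ≤ β := by
  have := h.one_sub_u_pos
  have := h.u_lt
  rw [h.u_sub_β, h.β_eq]
  gcongr
  nlinarith [h.u_pos]

/-- Keeps the Taylor errors of steps of length at most `β` below the threshold `β²/(1 - u)³` that
guarantees membership in `B(0, r₀)`. -/
theorem sq_div_le (h : SmaleParameters u β) {d S T : ℝ} (hd0 : 0 ≤ d) (hd : d ≤ β) (hS : S ≤ u)
    (hT : T ≤ u) : d ^ 2 / ((1 - S) ^ 2 * (1 - T)) ≤ β ^ 2 / (1 - u) ^ 3 := by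
  have := h.one_sub_u_pos
  have e : (1 - u) ^ 3 = (1 - u) ^ 2 * (1 - u) := by ring
  rw [e]
  gcongr

theorem discr_pos (h : SmaleParameters u β) {t : ℝ} (ht : t < u) : 0 < 2 * (1 - t) ^ 2 - 1 := by
  nlinarith [h.nonneg, h.u_lt_one]

/-- With `p = 1 - u` and `q = 1 - t` the difference is `2pq² - 2q + p`, whose discriminant `4 - 8p²`
in `q` is nonpositive. This is what halves the error at each step. -/
theorem two_mul_sub_le (h : SmaleParameters u β) (t : ℝ) :
    2 * (u - t) ≤ (1 - u) * (2 * (1 - t) ^ 2 - 1) := by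
  have h1 := h.nonneg
  have h2 := h.u_lt_one
  have h3 : 0 ≤ (1 - u) * (2 * (1 - u) * (1 - t) ^ 2 - 2 * (1 - t) + (1 - u)) := by
    nlinarith [sq_nonneg (2 * (1 - u) * (1 - t) - 1)]
  have h4 := nonneg_of_mul_nonneg_right h3 h.one_sub_u_pos
  nlinarith

theorem scalarNewtonStep_zero (h : SmaleParameters u β) : scalarNewtonStep u 0 = β := by
  have := h.one_sub_u_pos
  rw [scalarNewtonStep, h.β_eq]
  norm_num
  field_simp
  ring

theorem half_le_scalarNewtonStep (h : SmaleParameters u β) {t : ℝ} (ht : t < u) :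
    u - scalarNewtonStep u t ≤ 1 / 2 * (u - t) := by
  have h1 := h.one_sub_u_pos
  have h2 := h.discr_pos ht
  rw [scalarNewtonStep, sub_sub_cancel, div_le_iff₀ (by positivity)]
  have := h.two_mul_sub_le t
  nlinarith [sub_pos.2 ht]

theorem scalarNewtonStep_lt (h : SmaleParameters u β) {t : ℝ} (ht : t < u) :
    scalarNewtonStep u t < u := by
  have h1 := h.one_sub_u_pos
  have h2 := h.discr_pos ht
  have h3 := sub_pos.2 ht
  rw [scalarNewtonStep]
  have : 0 < (u - t) ^ 2 / ((1 - u) * (2 * (1 - t) ^ 2 - 1)) := by positivity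
  linarith

theorem lt_scalarNewtonStep (h : SmaleParameters u β) {t : ℝ} (ht : t < u) :
    t < scalarNewtonStep u t := by
  linarith [h.half_le_scalarNewtonStep ht]

/-- Let `T` be the step from `t`. The linearization of `φ` at `t` vanishes at `T`, so `φ(T)` equals
the Taylor error `(T - t)²/((1 - t)²(1 - T))`; the next step is `-φ(T)/φ'(T)`. -/
theorem scalarNewtonStep_scalarNewtonStep (h : SmaleParameters u β) {t : ℝ} (ht : t < u) :
    (1 - scalarNewtonStep u t) ^ 2 *
      ((scalarNewtonStep u t - t) ^ 2 / ((1 - t) ^ 2 * (1 - scalarNewtonStep u t))) =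
    (2 * (1 - scalarNewtonStep u t) ^ 2 - 1) *
      (scalarNewtonStep u (scalarNewtonStep u t) - scalarNewtonStep u t) := by
  have hp := h.one_sub_u_pos
  have hD := h.discr_pos ht
  have hT := h.scalarNewtonStep_lt ht
  have hDT := h.discr_pos hT
  have hq : 0 < 1 - t := by linarith
  have hQ : 0 < 1 - scalarNewtonStep u t := by linarith
  obtain ⟨T, hTdef⟩ : ∃ T, T = scalarNewtonStep u t := ⟨_, rfl⟩
  have hTT : scalarNewtonStep u T = u - (u - T) ^ 2 / ((1 - u) * (2 * (1 - T) ^ 2 - 1)) := rfl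
  rw [← hTdef] at hDT hQ hT ⊢
  have e1 : (T - t) * ((1 - u) * (2 * (1 - t) ^ 2 - 1)) =
      (u - t) * (1 - t) * (2 * (1 - u) * (1 - t) - 1) := by
    rw [hTdef, scalarNewtonStep]; field_simp; ring
  have e2 : (u - T) * ((1 - u) * (2 * (1 - t) ^ 2 - 1)) = (u - t) ^ 2 := by
    rw [hTdef, scalarNewtonStep]; field_simp; ring
  have e3 : (2 * (1 - u) * (1 - T) - 1) * (2 * (1 - t) ^ 2 - 1) =
      (2 * (1 - u) * (1 - t) - 1) ^ 2 := by
    linear_combination 2 * e2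
  -- After division by `1 - T`, two expressions for `φ(T)`: the Taylor error at `t` and the
  -- factorization through the zeros of `φ`.
  have e4 : (T - t) ^ 2 * (1 - u) = (1 - t) ^ 2 * ((u - T) * (2 * (1 - u) * (1 - T) - 1)) := by
    have hne : (1 - u) * (2 * (1 - t) ^ 2 - 1) ^ 2 ≠ 0 := by positivity
    apply mul_right_cancel₀ hne
    calc (T - t) ^ 2 * (1 - u) * ((1 - u) * (2 * (1 - t) ^ 2 - 1) ^ 2)
        = ((T - t) * ((1 - u) * (2 * (1 - t) ^ 2 - 1))) ^ 2 := by ring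
      _ = (1 - t) ^ 2 * ((u - t) ^ 2 * (2 * (1 - u) * (1 - t) - 1) ^ 2) := by rw [e1]; ring
      _ = _ := by rw [← e2, ← e3]; ring
  have e5 : (2 * (1 - T) ^ 2 - 1) * (scalarNewtonStep u T - T) * (1 - u) =
      (u - T) * (1 - T) * (2 * (1 - u) * (1 - T) - 1) := by
    rw [hTT]; field_simp; ring
  have e6 : (1 - T) ^ 2 * ((T - t) ^ 2 / ((1 - t) ^ 2 * (1 - T))) =
      (1 - T) * (T - t) ^ 2 / (1 - t) ^ 2 := by field_simp
  rw [e6, div_eq_iff (by positivity)]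
  apply mul_right_cancel₀ hp.ne'
  linear_combination (1 - T) * e4 - (1 - t) ^ 2 * e5

theorem sq_mul_baseChangeBound {s d : ℝ} (hs : s < 1) :
    (1 - s) ^ 2 * baseChangeBound s d = s ^ 2 * (1 - s) + (2 * s - s ^ 2) * d := by
  have : 0 < 1 - s := by linarith
  rw [baseChangeBound]; field_simp; ring

theorem le_of_sq_mul_le {s c : ℝ} (h : SmaleParameters u β) (hs : s < 1)
    (hc : (1 - u) ^ 5 * ((1 - s) ^ 2 * c) ≤ (1 - s) ^ 2 * (u ^ 2 * (1 - 2 * u) ^ 2)) :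
    c ≤ β ^ 2 / (1 - u) ^ 3 := by
  have hp := h.one_sub_u_pos
  have hq : 0 < (1 - s) ^ 2 := by have : 0 < 1 - s := by linarith
                                  positivity
  have e : β ^ 2 / (1 - u) ^ 3 = u ^ 2 * (1 - 2 * u) ^ 2 / (1 - u) ^ 5 := by
    rw [h.β_eq]; field_simp
  rw [e, le_div_iff₀ (by positivity)]
  refine le_of_mul_le_mul_left ?_ hq
  linarith

/-- For the base point `x₀ + u(y - x₀)`, within `u²` of `x₀` and `u(1 - u)` of a solution `y`. From
`x₀` itself the bound `u²/(1 - u)` would exceed the threshold. -/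
theorem crude_solution_bound (h : SmaleParameters u β) :
    (u * (1 - u)) ^ 2 / ((1 - u ^ 2) ^ 2 * (1 - u)) ≤ β ^ 2 / (1 - u) ^ 3 := by
  have hp := h.one_sub_u_pos
  have hu := h.u_lt
  have h0 := h.u_pos
  have e : (u * (1 - u)) ^ 2 / ((1 - u ^ 2) ^ 2 * (1 - u)) = (u / (1 + u)) ^ 2 / (1 - u) := by
    have : 1 - u ^ 2 = (1 - u) * (1 + u) := by ring
    rw [this]; field_simp
  have e2 : β ^ 2 / (1 - u) ^ 3 = (β / (1 - u)) ^ 2 / (1 - u) := by field_simp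
  rw [e, e2]
  gcongr ?_ ^ 2 / _
  rw [h.β_eq, div_div, div_le_div_iff₀ (by positivity) (by positivity)]
  nlinarith [mul_pos h0 h0]

/-- Same base point, now for the residual of `x₁`, which lies within `β + u²` of it. -/
theorem crude_base_bound (h : SmaleParameters u β) :
    baseChangeBound (u ^ 2) (β + u ^ 2) ≤ β ^ 2 / (1 - u) ^ 3 := by
  have hp := h.one_sub_u_pos
  have hu := h.u_lt
  have h0 := h.u_pos
  have hs : u ^ 2 < 1 := by nlinarith
  refine h.le_of_sq_mul_le hs ?_
  rw [sq_mul_baseChangeBound hs]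
  have e : (1 - u) ^ 5 * ((u ^ 2) ^ 2 * (1 - u ^ 2) + (2 * u ^ 2 - (u ^ 2) ^ 2) * (β + u ^ 2)) =
      ((1 - u) ^ 2 * u ^ 2) * ((1 - u) ^ 2 * (u ^ 2 * (1 - u ^ 2) * (1 - u) +
        (u * (1 - 2 * u) + u ^ 2 * (1 - u)) * (2 - u ^ 2))) := by
    rw [h.β_eq]; field_simp
  have e' : (1 - u ^ 2) ^ 2 * (u ^ 2 * (1 - 2 * u) ^ 2) =
      ((1 - u) ^ 2 * u ^ 2) * ((1 + u) ^ 2 * (1 - 2 * u) ^ 2) := by ring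
  rw [e, e']
  refine mul_le_mul_of_nonneg_left ?_ (by positivity)
  have hq : 0 ≤ (1 - u) ^ 2 := by positivity
  -- The middle steps are `v(1 - v) ≤ 1/4` for `v = (1 - u)²`, and `(1 + u)(1 - 2u) ≥ 1/2` on the
  -- range of `u`.
  calc _ ≤ (1 - u) ^ 2 * (1 - (1 - u) ^ 2) := by
        refine mul_le_mul_of_nonneg_left ?_ hq
        nlinarith [pow_pos h0 3, pow_pos h0 2, pow_pos h0 4, pow_pos h0 5,
          mul_pos (pow_pos h0 3) hp]
    _ ≤ (1 / 2) ^ 2 := by nlinarith [sq_nonneg ((1 - u) ^ 2 - 1 / 2)]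
    _ ≤ (1 - u - 2 * u ^ 2) ^ 2 := pow_le_pow_left₀ (by norm_num) (by nlinarith) 2
    _ = _ := by ring

theorem crude_bound (h : SmaleParameters u β) :
    (1 - u ^ 2) ^ 2 * ((u * (1 - u)) ^ 2 / ((1 - u ^ 2) ^ 2 * (1 - u)) +
      baseChangeBound (u ^ 2) (β + u ^ 2)) ≤ (2 * (1 - u ^ 2) ^ 2 - 1) * β := by
  have hp := h.one_sub_u_pos
  have hu := h.u_lt
  have h0 := h.u_pos
  have hs : u ^ 2 < 1 := by nlinarith
  have hs' : 0 < 1 - u ^ 2 := by linarith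
  rw [mul_add, sq_mul_baseChangeBound hs]
  have e : (1 - u ^ 2) ^ 2 * ((u * (1 - u)) ^ 2 / ((1 - u ^ 2) ^ 2 * (1 - u))) =
      u ^ 2 * (1 - u) := by field_simp
  rw [e]
  refine le_of_mul_le_mul_right ?_ hp
  have e2 : (2 * (1 - u ^ 2) ^ 2 - 1) * β * (1 - u) -
      (u ^ 2 * (1 - u) + ((u ^ 2) ^ 2 * (1 - u ^ 2) + (2 * u ^ 2 - (u ^ 2) ^ 2) * (β + u ^ 2))) *
        (1 - u) = u * (1 - 3 * u - 4 * u ^ 2 + 8 * u ^ 3 + 6 * u ^ 4 - 4 * u ^ 5 - 2 * u ^ 6) := by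
    linear_combination ((2 * (1 - u ^ 2) ^ 2 - 1) - (2 * u ^ 2 - (u ^ 2) ^ 2)) * h.eq
  have : 0 ≤ 1 - 3 * u - 4 * u ^ 2 + 8 * u ^ 3 + 6 * u ^ 4 - 4 * u ^ 5 - 2 * u ^ 6 := by
    -- The polynomial is barely positive at `293/1000`: `h3` and `h4` are the tangent-line bounds
    -- for `u³` and `u⁴` there, and `h5` absorbs the top degrees.
    have h3 : 0 ≤ (u - 293 / 1000) ^ 2 * (u + 2 * (293 / 1000)) := by positivity
    have h4 : 0 ≤ (u - 293 / 1000) ^ 2 *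
        (u ^ 2 + 2 * (293 / 1000) * u + 3 * (293 / 1000) ^ 2) := by positivity
    have h5 : 23 / 5 * u ^ 4 ≤ 6 * u ^ 4 - 4 * u ^ 5 - 2 * u ^ 6 := by
      have : 0 ≤ u ^ 4 * (7 / 5 - 4 * u - 2 * u ^ 2) := by
        refine mul_nonneg (by positivity) ?_
        nlinarith
      linarith
    nlinarith
  nlinarith [mul_nonneg h0.le this]

/-- For the base point three quarters of the way from `x₀` to `x₁`, once `γ‖y - x₁‖ ≤ β` places `y`
within `(u + 3β)/4` of it. -/
theorem refined_solution_bound (h : SmaleParameters u β) :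
    ((u + 3 * β) / 4) ^ 2 / ((1 - 3 / 4 * β) ^ 2 * (1 - u)) ≤ β ^ 2 / (1 - u) ^ 3 := by
  have hp := h.one_sub_u_pos
  have hu := h.u_lt
  have h0 := h.u_pos
  have hβ := h.β_pos
  have hβu := h.β_lt_u
  have hs : 0 < 1 - 3 / 4 * β := by linarith
  have e : ((u + 3 * β) / 4) ^ 2 / ((1 - 3 / 4 * β) ^ 2 * (1 - u)) =
      ((u + 3 * β) / 4 / (1 - 3 / 4 * β)) ^ 2 / (1 - u) := by field_simp
  have e2 : β ^ 2 / (1 - u) ^ 3 = (β / (1 - u)) ^ 2 / (1 - u) := by field_simp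
  rw [e, e2]
  gcongr ?_ ^ 2 / _
  rw [div_le_div_iff₀ hs hp]
  have key : 0 ≤ (1 - u) ^ 2 * (β * (1 - 3 / 4 * β) - (u + 3 * β) / 4 * (1 - u)) := by
    have : (1 - u) ^ 2 * (β * (1 - 3 / 4 * β) - (u + 3 * β) / 4 * (1 - u)) =
        u ^ 3 * (2 - 5 * u) / 4 := by
      rw [h.β_eq]; field_simp; ring
    rw [this]
    have : 0 < 2 - 5 * u := by linarith
    positivity
  linarith [nonneg_of_mul_nonneg_right key (by positivity)]

theorem refined_base_bound (h : SmaleParameters u β) :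
    baseChangeBound (3 / 4 * β) (1 / 4 * β) ≤ β ^ 2 / (1 - u) ^ 3 := by
  have hp := h.one_sub_u_pos
  have hu := h.u_lt
  have h0 := h.u_pos
  have hβ := h.β_pos
  have hβu := h.β_lt_u
  have hs : 0 < 1 - 3 / 4 * β := by linarith
  have h1 : β ^ 2 * (1 + 3 * β) ≤ β ^ 2 / (1 - u) ^ 3 := by
    rw [le_div_iff₀ (by positivity), mul_assoc]
    refine mul_le_of_le_one_right (by positivity) ?_
    calc (1 + 3 * β) * (1 - u) ^ 3 ≤ (1 + 3 * u) * (1 - u) ^ 3 := by gcongr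
      _ ≤ 1 := by nlinarith [pow_pos h0 2, pow_pos h0 4, mul_pos (pow_pos h0 2) hp]
  refine le_trans ?_ h1
  refine le_of_mul_le_mul_left ?_ (pow_pos hs 2)
  rw [sq_mul_baseChangeBound (by linarith)]
  have e1 : (3 / 4 * β) ^ 2 * (1 - 3 / 4 * β) + (2 * (3 / 4 * β) - (3 / 4 * β) ^ 2) * (1 / 4 * β) =
      β ^ 2 * (15 / 16 - 9 / 16 * β) := by ring
  have e2 : (1 - 3 / 4 * β) ^ 2 * (β ^ 2 * (1 + 3 * β)) =
      β ^ 2 * ((1 - 3 / 4 * β) ^ 2 * (1 + 3 * β)) := by ring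
  rw [e1, e2]
  refine mul_le_mul_of_nonneg_left ?_ (by positivity)
  nlinarith [h.β_lt, pow_pos hβ 3]

/-- The hypothesis is quadratic in `d`, since `d` also enters the distance from `y` to the base
point. For `φ` itself, with solution `u` and first iterate `β`, all estimates are equalities, so `d
= u - β` is a root (`e0`); the inequality fails on `(u - β, β]`. -/
theorem refined_bound (h : SmaleParameters u β) {d : ℝ} (hd : d ≤ β)
    (hle : (2 * (1 - 3 / 4 * β) ^ 2 - 1) * d ≤ (1 - 3 / 4 * β) ^ 2 *
      (((u + 3 * d) / 4) ^ 2 / ((1 - 3 / 4 * β) ^ 2 * (1 - u)) +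
        baseChangeBound (3 / 4 * β) (1 / 4 * β))) : d ≤ u - β := by
  have hp := h.one_sub_u_pos
  have hu := h.u_lt
  have h0 := h.u_pos
  have hβ := h.β_pos
  have hβu := h.β_lt_u
  have hs : 0 < 1 - 3 / 4 * β := by linarith
  rw [mul_add, sq_mul_baseChangeBound (by linarith)] at hle
  have e : (1 - 3 / 4 * β) ^ 2 * (((u + 3 * d) / 4) ^ 2 / ((1 - 3 / 4 * β) ^ 2 * (1 - u))) =
      ((u + 3 * d) / 4) ^ 2 / (1 - u) := by
    have := pow_pos hs 2
    rw [mul_div_assoc', mul_div_mul_left _ _ this.ne']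
  rw [e] at hle
  by_contra! hlt
  obtain ⟨η, hη⟩ : ∃ η, η = d - (u - β) := ⟨_, rfl⟩
  have hη0 : 0 < η := by linarith
  have hle2 : (2 * (1 - 3 / 4 * β) ^ 2 - 1) * d * (1 - u) ≤ ((u + 3 * d) / 4) ^ 2 +
      ((3 / 4 * β) ^ 2 * (1 - 3 / 4 * β) +
        (2 * (3 / 4 * β) - (3 / 4 * β) ^ 2) * (1 / 4 * β)) * (1 - u) := by
    have := mul_le_mul_of_nonneg_right hle hp.le
    rwa [add_mul, div_mul_cancel₀ _ hp.ne'] at this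
  have e0 : (2 * (1 - 3 / 4 * β) ^ 2 - 1) * (u - β) * (1 - u) = (u - 3 / 4 * β) ^ 2 +
      ((3 / 4 * β) ^ 2 * (1 - 3 / 4 * β) +
        (2 * (3 / 4 * β) - (3 / 4 * β) ^ 2) * (1 / 4 * β)) * (1 - u) := by
    rw [h.β_eq]; field_simp; ring
  have hd' : d = u - β + η := by linarith
  rw [hd'] at hle2
  have h1 : η * ((2 * (1 - 3 / 4 * β) ^ 2 - 1) * (1 - u)) ≤
      η * (3 / 2 * (u - 3 / 4 * β) + 9 / 16 * η) := by linarith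
  have h2 := le_of_mul_le_mul_left h1 hη0
  -- `d ≤ β` gives `η ≤ 2β - u`. The result is below `0.28`, whereas the left factor in `h2` is at
  -- least `(1 - u)/2 > 0.35`.
  have h3 : 3 / 2 * (u - 3 / 4 * β) + 9 / 16 * η ≤ 15 / 16 * u := by linarith
  have h4 : (1 : ℝ) / 2 ≤ 2 * (1 - 3 / 4 * β) ^ 2 - 1 := by nlinarith [h.β_lt]
  nlinarith

end SmaleParameters

end Scalar

/-! ### Newton iterates for the inclusion: majorization, limit, uniqueness and rates. -/

section Newton

variable {X Y : Type*} [NormedAddCommGroup X] [NormedSpace ℝ X]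
  [NormedAddCommGroup Y] [NormedSpace ℝ Y]

/-- The standing assumptions of the convergence analysis, with distances in `X` scaled by `γ` and
distances in `Y` scaled by `γ lam`. -/
structure NewtonSetting (f : X → Y) (F : X → Set Y) (x₀ x₁ : X) (lam γ u β rx₁ r₀ : ℝ) :
    Prop where
  majorant : SmaleMajorant f x₀ lam γ
  params : SmaleParameters u β
  lt_one : ∀ x, γ * ‖x - x₀‖ < u → lam * ‖fderiv ℝ f x - fderiv ℝ f x₀‖ < 1
  singleValued : ∀ x, γ * ‖x - x₀‖ < u →
    SingleValuedLipschitz (partialLinearizationInv f F x) (ball 0 r₀) (ball x₁ rx₁)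
      (lam / (1 - lam * ‖fderiv ℝ f x - fderiv ℝ f x₀‖))
  rx₁_pos : 0 < rx₁
  r₀_pos : 0 < r₀
  mem : x₁ ∈ partialLinearizationInv f F x₀ 0
  dist_le : γ * ‖x₁ - x₀‖ ≤ β
  lt_r₀ : β ^ 2 / (1 - u) ^ 3 < γ * (lam * r₀)

namespace NewtonSetting

variable {f : X → Y} {F : X → Set Y} {x₀ x₁ : X} {lam γ u β rx₁ r₀ : ℝ}

theorem mem_ball (h : NewtonSetting f F x₀ x₁ lam γ u β rx₁ r₀) {z : Y}
    (hz : γ * (lam * ‖z‖) ≤ β ^ 2 / (1 - u) ^ 3) : z ∈ ball (0 : Y) r₀ := by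
  rw [mem_ball_zero_iff]
  have h1 := hz.trans_lt h.lt_r₀
  have h2 := lt_of_mul_lt_mul_left h1 h.majorant.γ_pos.le
  exact lt_of_mul_lt_mul_left h2 h.majorant.lam_pos.le

theorem x₁_mem_base_change (h : NewtonSetting f F x₀ x₁ lam γ u β rx₁ r₀) (x : X) :
    x₁ ∈ partialLinearizationInv f F x
      (f x + fderiv ℝ f x (x₁ - x) - (f x₀ + fderiv ℝ f x₀ (x₁ - x₀))) := by
  have := mem_partialLinearizationInv_change (x' := x) h.mem
  rwa [zero_add] at this

theorem exists_newton_step (h : NewtonSetting f F x₀ x₁ lam γ u β rx₁ r₀) {x : X}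
    (hx : γ * ‖x - x₀‖ < u) : ∃ w, partialLinearizationInv f F x 0 ∩ ball x₁ rx₁ = {w} := by
  obtain ⟨w, hw, huniq⟩ := (h.singleValued x hx).1 0 (mem_ball_self h.r₀_pos)
  exact ⟨w, eq_singleton_iff_unique_mem.2 ⟨hw, huniq⟩⟩

variable [CompleteSpace Y]

/-- Lipschitz estimate between two points seen from the same base point. -/
theorem norm_sub_le (h : NewtonSetting f F x₀ x₁ lam γ u β rx₁ r₀) {x w w' : X} {z z' : Y}
    {S : ℝ} (hx : γ * ‖x - x₀‖ ≤ S) (hS : S < u)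
    (hw : w ∈ partialLinearizationInv f F x z) (hwb : w ∈ ball x₁ rx₁)
    (hw' : w' ∈ partialLinearizationInv f F x z') (hwb' : w' ∈ ball x₁ rx₁)
    (hz : γ * (lam * ‖z‖) ≤ β ^ 2 / (1 - u) ^ 3)
    (hz' : γ * (lam * ‖z'‖) ≤ β ^ 2 / (1 - u) ^ 3) :
    (2 * (1 - S) ^ 2 - 1) * (γ * ‖w - w'‖) ≤ (1 - S) ^ 2 * (γ * (lam * ‖z - z'‖)) := by
  have hS1 : 0 < 1 - S := by linarith [h.params.u_lt_one]
  have hxu := hx.trans_lt hS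
  have h1 := (h.singleValued x hxu).2 z (h.mem_ball hz) z' (h.mem_ball hz') w ⟨hw, hwb⟩ w'
    ⟨hw', hwb'⟩
  have hlt := h.lt_one x hxu
  rw [div_mul_eq_mul_div, le_div_iff₀ (by linarith)] at h1
  have h2 := h.majorant.norm_fderiv_sub_le hx (by linarith)
  -- `2 - 1/(1 - S)² = -φ'(S)` is a lower bound for `1 - lam ‖f'(x) - f'(x₀)‖`.
  have h3 : ‖w - w'‖ * (2 - 1 / (1 - S) ^ 2) ≤ lam * ‖z - z'‖ := by
    refine le_trans (mul_le_mul_of_nonneg_left ?_ (norm_nonneg _)) h1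
    linarith
  have e : (2 * (1 - S) ^ 2 - 1) * (γ * ‖w - w'‖) =
      (1 - S) ^ 2 * (γ * (‖w - w'‖ * (2 - 1 / (1 - S) ^ 2))) := by field_simp
  rw [e]
  have := h.majorant.γ_pos
  gcongr

/-- The change splits into the Taylor error of `f` from `x₀` to `x` and the change of derivative
applied to `w - x`. -/
theorem norm_base_change_le (h : NewtonSetting f F x₀ x₁ lam γ u β rx₁ r₀) {x w : X} {S d : ℝ}
    (hx : γ * ‖x - x₀‖ ≤ S) (hS : S < u) (hd : γ * ‖w - x‖ ≤ d) :
    γ * (lam * ‖f x + fderiv ℝ f x (w - x) - (f x₀ + fderiv ℝ f x₀ (w - x₀))‖) ≤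
      baseChangeBound S d := by
  have hγ := h.majorant.γ_pos
  have hlam := h.majorant.lam_pos
  have hS1 : S < 1 := by linarith [h.params.u_lt_one]
  have hS0 : 0 ≤ S := le_trans (by positivity) hx
  have h1 := h.majorant.norm_sub_linearization_le (x := x₀) (y := x) (S := 0) (by simp) one_pos
    hx hS1
  have h2 := h.majorant.norm_fderiv_sub_le hx hS1
  have hpos : 0 < 1 - S := by linarith
  have e : f x + fderiv ℝ f x (w - x) - (f x₀ + fderiv ℝ f x₀ (w - x₀)) =
      (f x - (f x₀ + fderiv ℝ f x₀ (x - x₀))) + (fderiv ℝ f x - fderiv ℝ f x₀) (w - x) := by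
    have : w - x₀ = (w - x) + (x - x₀) := by abel
    rw [this, map_add, _root_.sub_apply]
    abel
  have h3 : γ * (lam * ‖(fderiv ℝ f x - fderiv ℝ f x₀) (w - x)‖) ≤
      (1 / (1 - S) ^ 2 - 1) * d := by
    calc γ * (lam * ‖(fderiv ℝ f x - fderiv ℝ f x₀) (w - x)‖)
        ≤ γ * (lam * (‖fderiv ℝ f x - fderiv ℝ f x₀‖ * ‖w - x‖)) := by
          gcongr; exact ContinuousLinearMap.le_opNorm _ _
      _ = lam * ‖fderiv ℝ f x - fderiv ℝ f x₀‖ * (γ * ‖w - x‖) := by ring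
      _ ≤ _ := mul_le_mul h2 hd (by positivity) (le_trans (by positivity) h2)
  rw [e]
  calc _ ≤ γ * (lam * (‖f x - (f x₀ + fderiv ℝ f x₀ (x - x₀))‖ +
        ‖(fderiv ℝ f x - fderiv ℝ f x₀) (w - x)‖)) := by gcongr; exact norm_add_le _ _
    _ = γ * (lam * ‖f x - (f x₀ + fderiv ℝ f x₀ (x - x₀))‖) +
        γ * (lam * ‖(fderiv ℝ f x - fderiv ℝ f x₀) (w - x)‖) := by ring
    _ ≤ (γ * ‖x - x₀‖) ^ 2 / ((1 - 0) ^ 2 * (1 - S)) + (1 / (1 - S) ^ 2 - 1) * d := by gcongr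
    _ ≤ _ := by
        rw [baseChangeBound, sub_zero, one_pow, one_mul]
        gcongr

theorem norm_solution_error_le (h : NewtonSetting f F x₀ x₁ lam γ u β rx₁ r₀) {x y : X} {S T d : ℝ}
    (hx : γ * ‖x - x₀‖ ≤ S) (hS : S < 1) (hy : γ * ‖y - x₀‖ ≤ T) (hT : T < 1)
    (hd : γ * ‖y - x‖ ≤ d) :
    γ * (lam * ‖f x + fderiv ℝ f x (y - x) - f y‖) ≤ d ^ 2 / ((1 - S) ^ 2 * (1 - T)) := by
  have hγ := h.majorant.γ_pos
  have hpos : 0 < 1 - S := by linarith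
  have hpos : 0 < 1 - T := by linarith
  rw [norm_sub_rev]
  refine (h.majorant.norm_sub_linearization_le hx hS hy hT).trans ?_
  gcongr

/-- Distance between a solution and `x₁`, computed from any base point seeing both. -/
theorem norm_solution_sub_x₁_le (h : NewtonSetting f F x₀ x₁ lam γ u β rx₁ r₀) {x y : X}
    {S d d₁ : ℝ} (hx : γ * ‖x - x₀‖ ≤ S) (hS : S < u) (hy : γ * ‖y - x₀‖ ≤ u)
    (hyb : y ∈ ball x₁ rx₁) (hsol : (0 : Y) ∈ generalizedSum f F y)
    (hd : γ * ‖y - x‖ ≤ d) (hd₁ : γ * ‖x₁ - x‖ ≤ d₁)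
    (hdR : d ^ 2 / ((1 - S) ^ 2 * (1 - u)) ≤ β ^ 2 / (1 - u) ^ 3)
    (hd₁R : baseChangeBound S d₁ ≤ β ^ 2 / (1 - u) ^ 3) :
    (2 * (1 - S) ^ 2 - 1) * (γ * ‖y - x₁‖) ≤
      (1 - S) ^ 2 * (d ^ 2 / ((1 - S) ^ 2 * (1 - u)) + baseChangeBound S d₁) := by
  have hγ := h.majorant.γ_pos
  have hlam := h.majorant.lam_pos
  have hu := h.params.u_lt_one
  have h1 := h.norm_solution_error_le hx (hS.trans hu) hy hu hd
  have h2 := h.norm_base_change_le hx hS hd₁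
  refine (h.norm_sub_le hx hS (mem_partialLinearizationInv_of_solution hsol x) hyb
    (h.x₁_mem_base_change x) (mem_ball_self h.rx₁_pos) (h1.trans hdR) (h2.trans hd₁R)).trans ?_
  refine mul_le_mul_of_nonneg_left ?_ (sq_nonneg _)
  refine le_trans ?_ (add_le_add h1 h2)
  rw [← mul_add, ← mul_add]
  gcongr
  exact _root_.norm_sub_le _ _

/-- Moving the base point a fraction `u` of the way from `x₀` to `y` brings the residuals of both
`y` and `x₁` below the threshold. -/
theorem norm_solution_sub_x₁_le_β (h : NewtonSetting f F x₀ x₁ lam γ u β rx₁ r₀) {y : X}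
    (hy : γ * ‖y - x₀‖ ≤ u) (hyb : y ∈ ball x₁ rx₁) (hsol : (0 : Y) ∈ generalizedSum f F y) :
    γ * ‖y - x₁‖ ≤ β := by
  have hγ := h.majorant.γ_pos
  have hu := h.params.u_lt_one
  have hu0 := h.params.u_pos
  have hS : u ^ 2 < u := by nlinarith
  have hx : γ * ‖x₀ + u • (y - x₀) - x₀‖ ≤ u ^ 2 := by
    rw [add_sub_cancel_left, norm_smul, Real.norm_of_nonneg hu0.le]
    nlinarith
  have hd : γ * ‖y - (x₀ + u • (y - x₀))‖ ≤ u * (1 - u) := by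
    have e : y - (x₀ + u • (y - x₀)) = (1 - u) • (y - x₀) := by module
    rw [e, norm_smul, Real.norm_of_nonneg h.params.one_sub_u_pos.le]
    nlinarith [h.params.one_sub_u_pos]
  have hd₁ : γ * ‖x₁ - (x₀ + u • (y - x₀))‖ ≤ β + u ^ 2 := by
    have e : x₁ - (x₀ + u • (y - x₀)) = (x₁ - x₀) - (x₀ + u • (y - x₀) - x₀) := by abel
    rw [e]
    calc _ ≤ γ * (‖x₁ - x₀‖ + ‖x₀ + u • (y - x₀) - x₀‖) := by
          gcongr; exact _root_.norm_sub_le _ _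
      _ ≤ _ := by rw [mul_add]; exact add_le_add h.dist_le hx
  have := (h.norm_solution_sub_x₁_le hx hS hy hyb hsol hd hd₁ h.params.crude_solution_bound
    h.params.crude_base_bound).trans h.params.crude_bound
  exact le_of_mul_le_mul_left this (h.params.discr_pos hS)

/-- The crude bound `β` makes the base point `x₀ + ¾(x₁ - x₀)` admissible. The distance from `y` to
it is itself bounded through `γ‖y - x₁‖`, which gives a self-improving inequality. -/
theorem norm_solution_sub_x₁_le_sub (h : NewtonSetting f F x₀ x₁ lam γ u β rx₁ r₀) {y : X}
    (hy : γ * ‖y - x₀‖ ≤ u) (hyb : y ∈ ball x₁ rx₁) (hsol : (0 : Y) ∈ generalizedSum f F y) :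
    γ * ‖y - x₁‖ ≤ u - β := by
  have hγ := h.majorant.γ_pos
  have hβ := h.params.β_pos
  have hβu := h.params.β_lt_u
  have hu := h.params.u_lt_one
  have hcrude := h.norm_solution_sub_x₁_le_β hy hyb hsol
  have hS : 3 / 4 * β < u := by linarith
  obtain ⟨x, hxdef⟩ : ∃ x, x = x₀ + (3 / 4 : ℝ) • (x₁ - x₀) := ⟨_, rfl⟩
  have hx : γ * ‖x - x₀‖ ≤ 3 / 4 * β := by
    rw [hxdef, add_sub_cancel_left, norm_smul, Real.norm_of_nonneg (by norm_num)]
    linarith [h.dist_le]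
  have hd : γ * ‖y - x‖ ≤ (u + 3 * (γ * ‖y - x₁‖)) / 4 := by
    have e : y - x = (1 / 4 : ℝ) • (y - x₀) + (3 / 4 : ℝ) • (y - x₁) := by rw [hxdef]; module
    calc γ * ‖y - x‖ ≤ γ * (1 / 4 * ‖y - x₀‖ + 3 / 4 * ‖y - x₁‖) := by
          rw [e]
          refine mul_le_mul_of_nonneg_left ((norm_add_le _ _).trans (le_of_eq ?_)) hγ.le
          rw [norm_smul, norm_smul, Real.norm_of_nonneg (by norm_num),
            Real.norm_of_nonneg (by norm_num)]
      _ ≤ _ := by linarith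
  have hd₁ : γ * ‖x₁ - x‖ ≤ 1 / 4 * β := by
    have e : x₁ - x = (1 / 4 : ℝ) • (x₁ - x₀) := by rw [hxdef]; module
    rw [e, norm_smul, Real.norm_of_nonneg (by norm_num)]
    linarith [h.dist_le]
  refine h.params.refined_bound hcrude ?_
  refine h.norm_solution_sub_x₁_le hx hS hy hyb hsol hd hd₁
    (le_trans ?_ h.params.refined_solution_bound) h.params.refined_base_bound
  have h1 : 0 < 1 - 3 / 4 * β := by linarith
  have h2 := h.params.one_sub_u_pos
  have h3 : 0 ≤ γ * ‖y - x₁‖ := by positivity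
  have h4 := h.params.u_pos
  gcongr

/-- One Newton step decreases the distance to a solution quadratically. -/
theorem norm_solution_sub_newton_le (h : NewtonSetting f F x₀ x₁ lam γ u β rx₁ r₀) {x w y : X}
    {t T : ℝ} (hx : γ * ‖x - x₀‖ ≤ t) (ht : t < u)
    (hw : w ∈ partialLinearizationInv f F x 0) (hwb : w ∈ ball x₁ rx₁)
    (hy : γ * ‖y - x₀‖ ≤ T) (hT : T < 1) (hyb : y ∈ ball x₁ rx₁)
    (hsol : (0 : Y) ∈ generalizedSum f F y)
    (hR : (γ * ‖y - x‖) ^ 2 / ((1 - t) ^ 2 * (1 - T)) ≤ β ^ 2 / (1 - u) ^ 3) :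
    γ * ‖y - w‖ ≤ (γ * ‖y - x‖) ^ 2 / ((1 - T) * (2 * (1 - t) ^ 2 - 1)) := by
  have hu := h.params.u_lt_one
  have hp := h.params.one_sub_u_pos
  have h1 := h.norm_solution_error_le hx (ht.trans hu) hy hT le_rfl
  have hpos : 0 ≤ β ^ 2 / (1 - u) ^ 3 := by positivity
  have h2 := h.norm_sub_le hx ht (mem_partialLinearizationInv_of_solution hsol x) hyb hw hwb
    (h1.trans hR) (by simpa using hpos)
  rw [sub_zero] at h2
  have h3 : 0 < 1 - t := by linarith
  have h4 : 0 < 1 - T := by linarith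
  have hD := h.params.discr_pos ht
  have h5 := h2.trans (mul_le_mul_of_nonneg_left h1 (sq_nonneg (1 - t)))
  rw [le_div_iff₀ (by positivity)]
  have e : (1 - t) ^ 2 * ((γ * ‖y - x‖) ^ 2 / ((1 - t) ^ 2 * (1 - T))) =
      (γ * ‖y - x‖) ^ 2 / (1 - T) := by field_simp
  rw [e, le_div_iff₀ h4] at h5
  linarith

/-- One step of the majorization of the Newton iteration by the scalar one. -/
theorem norm_newton_sub_le (h : NewtonSetting f F x₀ x₁ lam γ u β rx₁ r₀) {x w v : X} {t : ℝ}
    (ht : t < u) (hx : γ * ‖x - x₀‖ ≤ t)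
    (hw : w ∈ partialLinearizationInv f F x 0) (hwb : w ∈ ball x₁ rx₁)
    (hwx : γ * ‖w - x‖ ≤ scalarNewtonStep u t - t)
    (hβt : scalarNewtonStep u t - t ≤ β)
    (hv : v ∈ partialLinearizationInv f F w 0) (hvb : v ∈ ball x₁ rx₁) :
    γ * ‖v - w‖ ≤ scalarNewtonStep u (scalarNewtonStep u t) - scalarNewtonStep u t := by
  have hu := h.params.u_lt_one
  have hp := h.params.one_sub_u_pos
  have hγ := h.majorant.γ_pos
  have hT := h.params.scalarNewtonStep_lt ht
  have hwx₀ : γ * ‖w - x₀‖ ≤ scalarNewtonStep u t := by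
    have e : w - x₀ = (w - x) + (x - x₀) := by abel
    calc γ * ‖w - x₀‖ ≤ γ * (‖w - x‖ + ‖x - x₀‖) := by rw [e]; gcongr; exact norm_add_le _ _
      _ ≤ _ := by linarith
  -- Seen from `w`, the point `w` has as right side the Taylor error of `f` at `x`, and `v` has `0`.
  have hmem := mem_partialLinearizationInv_change (x' := w) hw
  rw [sub_self, map_zero, add_zero, zero_add] at hmem
  have h1 : γ * (lam * ‖f w - (f x + fderiv ℝ f x (w - x))‖) ≤
      (scalarNewtonStep u t - t) ^ 2 / ((1 - t) ^ 2 * (1 - scalarNewtonStep u t)) := by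
    rw [norm_sub_rev]
    exact h.norm_solution_error_le hx (ht.trans hu) hwx₀ (hT.trans hu) hwx
  have hpos : 0 ≤ β ^ 2 / (1 - u) ^ 3 := by positivity
  have h2 := h.norm_sub_le hwx₀ hT hv hvb hmem hwb (by simpa using hpos)
    (h1.trans (h.params.sq_div_le (le_trans (by positivity) hwx) hβt ht.le hT.le))
  rw [zero_sub, norm_neg] at h2
  have h3 := h2.trans (mul_le_mul_of_nonneg_left h1 (sq_nonneg _))
  rw [h.params.scalarNewtonStep_scalarNewtonStep ht] at h3
  exact le_of_mul_le_mul_left h3 (h.params.discr_pos hT)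

end NewtonSetting

/-- The scalar Newton iterates started at `0`. -/
noncomputable def scalarNewtonSeq (u : ℝ) (k : ℕ) : ℝ := (scalarNewtonStep u)^[k] 0

theorem scalarNewtonSeq_succ (u : ℝ) (k : ℕ) :
    scalarNewtonSeq u (k + 1) = scalarNewtonStep u (scalarNewtonSeq u k) :=
  Function.iterate_succ_apply' _ _ _

namespace SmaleParameters

variable {u β : ℝ}

theorem scalarNewtonSeq_lt (h : SmaleParameters u β) (k : ℕ) : scalarNewtonSeq u k < u := by
  induction k with
  | zero => exact h.u_pos
  | succ k ih => rw [scalarNewtonSeq_succ]; exact h.scalarNewtonStep_lt ih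

theorem scalarNewtonSeq_one (h : SmaleParameters u β) : scalarNewtonSeq u 1 = β := by
  rw [scalarNewtonSeq_succ]; exact h.scalarNewtonStep_zero

theorem scalarNewtonSeq_mono (h : SmaleParameters u β) : Monotone (scalarNewtonSeq u) :=
  monotone_nat_of_le_succ fun k => by
    rw [scalarNewtonSeq_succ]
    exact (h.lt_scalarNewtonStep (h.scalarNewtonSeq_lt k)).le

theorem β_le_scalarNewtonSeq (h : SmaleParameters u β) (k : ℕ) :
    β ≤ scalarNewtonSeq u (k + 1) := by
  rw [← h.scalarNewtonSeq_one]
  exact h.scalarNewtonSeq_mono (by omega)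

theorem u_sub_scalarNewtonSeq_le (h : SmaleParameters u β) (k : ℕ) :
    u - scalarNewtonSeq u k ≤ u * (1 / 2) ^ k := by
  induction k with
  | zero => simp [scalarNewtonSeq]
  | succ k ih =>
    rw [scalarNewtonSeq_succ, pow_succ]
    have := h.half_le_scalarNewtonStep (h.scalarNewtonSeq_lt k)
    linarith

theorem scalarNewtonSeq_sub_le_β (h : SmaleParameters u β) (k : ℕ) :
    scalarNewtonSeq u (k + 1) - scalarNewtonSeq u k ≤ β := by
  rcases k with _ | k
  · rw [zero_add, h.scalarNewtonSeq_one]; simp [scalarNewtonSeq]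
  · linarith [h.β_le_scalarNewtonSeq k, h.scalarNewtonSeq_lt (k + 1 + 1), h.u_sub_β_le]

theorem tendsto_u_sub_scalarNewtonSeq (h : SmaleParameters u β) :
    Tendsto (fun k => u - scalarNewtonSeq u k) atTop (𝓝 0) := by
  have h1 : Tendsto (fun k : ℕ => u * (1 / 2 : ℝ) ^ k) atTop (𝓝 (u * 0)) :=
    (tendsto_pow_atTop_nhds_zero_of_lt_one (by norm_num) (by norm_num)).const_mul u
  rw [mul_zero] at h1
  exact squeeze_zero (fun k => by linarith [h.scalarNewtonSeq_lt k])
    h.u_sub_scalarNewtonSeq_le h1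

end SmaleParameters

namespace NewtonSetting

variable {f : X → Y} {F : X → Set Y} {x₀ x₁ : X} {lam γ u β rx₁ r₀ : ℝ}

/-- The Newton iterates converge, at the rate of the scalar iterates. -/
theorem exists_limit [CompleteSpace X] (h : NewtonSetting f F x₀ x₁ lam γ u β rx₁ r₀) {x : ℕ → X}
    (hx : ∀ k, γ * ‖x (k + 1) - x k‖ ≤ scalarNewtonSeq u (k + 1) - scalarNewtonSeq u k) :
    ∃ xs, Tendsto x atTop (𝓝 xs) ∧ ∀ k, γ * ‖xs - x k‖ ≤ u - scalarNewtonSeq u k := by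
  have hγ := h.majorant.γ_pos
  have hc : CauchySeq x := by
    refine cauchySeq_of_le_geometric (1 / 2) (u / γ) (by norm_num) fun k => ?_
    rw [dist_comm, dist_eq_norm, div_mul_eq_mul_div, le_div_iff₀ hγ]
    linarith [hx k, h.params.scalarNewtonSeq_lt (k + 1), h.params.u_sub_scalarNewtonSeq_le k]
  obtain ⟨xs, hxs⟩ := cauchySeq_tendsto_of_complete hc
  refine ⟨xs, hxs, fun k => ?_⟩
  have hle : ∀ j, γ * ‖x (k + j) - x k‖ ≤ scalarNewtonSeq u (k + j) - scalarNewtonSeq u k := by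
    intro j
    induction j with
    | zero => simp
    | succ j ih =>
      have e : x (k + (j + 1)) - x k = (x (k + j + 1) - x (k + j)) + (x (k + j) - x k) := by
        rw [← add_assoc]; abel
      calc γ * ‖x (k + (j + 1)) - x k‖
          ≤ γ * (‖x (k + j + 1) - x (k + j)‖ + ‖x (k + j) - x k‖) := by
            rw [e]; gcongr; exact norm_add_le _ _
        _ ≤ _ := by rw [← add_assoc]; linarith [hx (k + j)]
  have hlim : Tendsto (fun j => γ * ‖x (k + j) - x k‖) atTop (𝓝 (γ * ‖xs - x k‖)) := by
    have : Tendsto (fun j => x (k + j)) atTop (𝓝 xs) := by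
      simpa only [add_comm k] using (tendsto_add_atTop_iff_nat k).2 hxs
    exact ((this.sub_const _).norm).const_mul γ
  refine le_of_tendsto' hlim fun j => (hle j).trans ?_
  linarith [h.params.scalarNewtonSeq_lt (k + j)]

variable [CompleteSpace Y]

theorem exists_newton_sequence (h : NewtonSetting f F x₀ x₁ lam γ u β rx₁ r₀) :
    ∃ x : ℕ → X, x 0 = x₀ ∧ x 1 = x₁ ∧
      (∀ k, partialLinearizationInv f F (x k) 0 ∩ ball x₁ rx₁ = {x (k + 1)}) ∧
      (∀ k, γ * ‖x k - x₀‖ ≤ scalarNewtonSeq u k) ∧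
      ∀ k, γ * ‖x (k + 1) - x k‖ ≤ scalarNewtonSeq u (k + 1) - scalarNewtonSeq u k := by
  have hγ := h.majorant.γ_pos
  have hstep : ∀ x : X, ∃ w, γ * ‖x - x₀‖ < u →
      partialLinearizationInv f F x 0 ∩ ball x₁ rx₁ = {w} := fun x => by
    by_cases hx : γ * ‖x - x₀‖ < u
    · obtain ⟨w, hw⟩ := h.exists_newton_step hx
      exact ⟨w, fun _ => hw⟩
    · exact ⟨x, fun hx' => absurd hx' hx⟩
  choose N hN using hstep
  set x : ℕ → X := fun k => N^[k] x₀ with hxdef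
  have hsucc : ∀ k, x (k + 1) = N (x k) := fun k => Function.iterate_succ_apply' _ _ _
  have hx0 : x 0 = x₀ := rfl
  have hx₀u : γ * ‖x₀ - x₀‖ < u := by simpa using h.params.u_pos
  have hx1 : x 1 = x₁ := by
    have h1 : x₁ ∈ ({N x₀} : Set X) := hN x₀ hx₀u ▸ ⟨h.mem, mem_ball_self h.rx₁_pos⟩
    exact h1.symm
  have hmem : ∀ k, γ * ‖x k - x₀‖ ≤ scalarNewtonSeq u k →
      partialLinearizationInv f F (x k) 0 ∩ ball x₁ rx₁ = {x (k + 1)} := fun k hk => by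
    rw [hsucc]
    exact hN _ (hk.trans_lt (h.params.scalarNewtonSeq_lt k))
  have key : ∀ k, γ * ‖x k - x₀‖ ≤ scalarNewtonSeq u k ∧
      γ * ‖x (k + 1) - x k‖ ≤ scalarNewtonSeq u (k + 1) - scalarNewtonSeq u k := by
    intro k
    induction k with
    | zero =>
      rw [zero_add, h.params.scalarNewtonSeq_one, hx1, hx0]
      simpa [scalarNewtonSeq] using h.dist_le
    | succ k ih =>
      obtain ⟨ih1, ih2⟩ := ih
      have h1 : γ * ‖x (k + 1) - x₀‖ ≤ scalarNewtonSeq u (k + 1) := by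
        have e : x (k + 1) - x₀ = (x (k + 1) - x k) + (x k - x₀) := by abel
        calc γ * ‖x (k + 1) - x₀‖ ≤ γ * (‖x (k + 1) - x k‖ + ‖x k - x₀‖) := by
              rw [e]; gcongr; exact norm_add_le _ _
          _ ≤ _ := by linarith
      refine ⟨h1, ?_⟩
      have hw : x (k + 1) ∈ partialLinearizationInv f F (x k) 0 ∩ ball x₁ rx₁ := by
        rw [hmem k ih1]; rfl
      have hv : x (k + 1 + 1) ∈ partialLinearizationInv f F (x (k + 1)) 0 ∩ ball x₁ rx₁ := by
        rw [hmem (k + 1) h1]; rfl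
      have hβ := h.params.scalarNewtonSeq_sub_le_β k
      rw [scalarNewtonSeq_succ u (k + 1), scalarNewtonSeq_succ u k]
      rw [scalarNewtonSeq_succ u k] at ih2 hβ
      exact h.norm_newton_sub_le (h.params.scalarNewtonSeq_lt k) ih1 hw.1 hw.2 ih2 hβ hv.1 hv.2
  exact ⟨x, hx0, hx1, fun k => hmem k (key k).1, fun k => (key k).1, fun k => (key k).2⟩

/-- The limit of the Newton iterates is a solution in the open ball around `x₁`. -/
theorem limit_mem (h : NewtonSetting f F x₀ x₁ lam γ u β rx₁ r₀) {x : ℕ → X}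
    (hmem : ∀ k, partialLinearizationInv f F (x k) 0 ∩ ball x₁ rx₁ = {x (k + 1)})
    {xs : X} (hxs : Tendsto x atTop (𝓝 xs)) (hxs₀ : γ * ‖xs - x₀‖ ≤ u)
    (hxs₁ : γ * ‖xs - x₁‖ ≤ u - β) :
    xs ∈ ball x₁ rx₁ ∧ (0 : Y) ∈ generalizedSum f F xs := by
  have hu := h.params.u_lt_one
  have hγ := h.majorant.γ_pos
  have hβu := h.params.β_lt_u
  have han := h.majorant.analyticAt xs (hxs₀.trans_lt hu)
  -- A direct passage to the limit would only reach the closed ball. Seen from the fixed base `x₁`,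
  -- the iterates have right sides `z j → zs` with `zs ∈ B(0, r₀)`; the value `w` at `zs` lies in
  -- the open ball, and the Lipschitz bound forces `x (j + 1) → w`.
  set zs : Y := f x₁ + fderiv ℝ f x₁ (xs - x₁) - f xs with hzs
  set z : ℕ → Y := fun j => f x₁ + fderiv ℝ f x₁ (x (j + 1) - x₁) -
    (f (x j) + fderiv ℝ f (x j) (x (j + 1) - x j)) with hz
  have hR : γ * (lam * ‖zs‖) ≤ β ^ 2 / (1 - u) ^ 3 :=
    (h.norm_solution_error_le h.dist_le (hβu.trans hu) hxs₀ hu hxs₁).trans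
      (h.params.sq_div_le (by linarith) h.params.u_sub_β_le hβu.le le_rfl)
  have hzsb := h.mem_ball hR
  have hxs' : Tendsto (fun j => x (j + 1)) atTop (𝓝 xs) := (tendsto_add_atTop_iff_nat 1).2 hxs
  have hzt : Tendsto z atTop (𝓝 zs) := by
    have t1 : Tendsto (fun j => fderiv ℝ f x₁ (x (j + 1) - x₁)) atTop
        (𝓝 (fderiv ℝ f x₁ (xs - x₁))) :=
      ((fderiv ℝ f x₁).continuous.tendsto _).comp (hxs'.sub_const x₁)
    have t2 : Tendsto (fun j => f (x j)) atTop (𝓝 (f xs)) := han.continuousAt.tendsto.comp hxs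
    have t3 : Tendsto (fun j => fderiv ℝ f (x j) (x (j + 1) - x j)) atTop (𝓝 0) := by
      have a : Tendsto (fun j => fderiv ℝ f (x j)) atTop (𝓝 (fderiv ℝ f xs)) :=
        han.fderiv.continuousAt.tendsto.comp hxs
      have b := hxs'.sub hxs
      have c := ((isBoundedBilinearMap_apply (𝕜 := ℝ) (E := X) (F := Y)).continuous.tendsto
        (fderiv ℝ f xs, xs - xs)).comp (a.prodMk_nhds b)
      rwa [sub_self, map_zero] at c
    have := (t1.const_add (f x₁)).sub (t2.add t3)
    rwa [add_zero] at this
  have hzmem : ∀ j, x (j + 1) ∈ partialLinearizationInv f F x₁ (z j) ∩ ball x₁ rx₁ := fun j => by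
    have hj : x (j + 1) ∈ partialLinearizationInv f F (x j) 0 ∩ ball x₁ rx₁ := by
      rw [hmem j]; rfl
    have := mem_partialLinearizationInv_change (x' := x₁) hj.1
    rw [zero_add] at this
    exact ⟨this, hj.2⟩
  obtain ⟨hex, hlip⟩ := h.singleValued x₁ (h.dist_le.trans_lt hβu)
  obtain ⟨w, hw, -⟩ := hex zs hzsb
  have hev : ∀ᶠ j in atTop, z j ∈ ball (0 : Y) r₀ := hzt (isOpen_ball.mem_nhds hzsb)
  have hlim : Tendsto (fun j => x (j + 1)) atTop (𝓝 w) := by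
    rw [tendsto_iff_norm_sub_tendsto_zero]
    have hb : Tendsto (fun j => lam / (1 - lam * ‖fderiv ℝ f x₁ - fderiv ℝ f x₀‖) * ‖z j - zs‖)
        atTop (𝓝 0) := by
      have := (tendsto_iff_norm_sub_tendsto_zero.1 hzt).const_mul
        (lam / (1 - lam * ‖fderiv ℝ f x₁ - fderiv ℝ f x₀‖))
      simpa using this
    refine squeeze_zero' (Eventually.of_forall fun _ => norm_nonneg _) ?_ hb
    filter_upwards [hev] with j hj
    exact hlip _ hj _ hzsb _ (hzmem j) _ hw
  have hwx : w = xs := tendsto_nhds_unique hlim hxs'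
  subst hwx
  exact ⟨hw.2, solution_of_mem_partialLinearizationInv hw.1⟩

theorem newton_rate_succ (h : NewtonSetting f F x₀ x₁ lam γ u β rx₁ r₀) {x w y : X} {t : ℝ}
    (hβt : β ≤ t) (htu : t < u) (hx : γ * ‖x - x₀‖ ≤ t)
    (hw : w ∈ partialLinearizationInv f F x 0) (hwb : w ∈ ball x₁ rx₁)
    (hy : γ * ‖y - x₀‖ ≤ u) (hyb : y ∈ ball x₁ rx₁) (hsol : (0 : Y) ∈ generalizedSum f F y)
    (hyx : γ * ‖y - x‖ ≤ u - t) :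
    γ * ‖y - w‖ ≤ (γ * ‖y - x‖) ^ 2 / ((1 - u) * (2 * (1 - t) ^ 2 - 1)) := by
  have hγ := h.majorant.γ_pos
  refine h.norm_solution_sub_newton_le hx htu hw hwb hy h.params.u_lt_one hyb hsol
    (h.params.sq_div_le (by positivity) ?_ htu.le le_rfl)
  linarith [h.params.u_sub_β_le]

/-- Any solution is approached by the Newton iterates at the rate of the scalar iterates. -/
theorem norm_solution_sub_iterate_le (h : NewtonSetting f F x₀ x₁ lam γ u β rx₁ r₀) {x : ℕ → X}
    (h1 : x 1 = x₁)
    (hmem : ∀ k, partialLinearizationInv f F (x k) 0 ∩ ball x₁ rx₁ = {x (k + 1)})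
    (hx₀ : ∀ k, γ * ‖x k - x₀‖ ≤ scalarNewtonSeq u k) {y : X} (hy : γ * ‖y - x₀‖ ≤ u)
    (hyb : y ∈ ball x₁ rx₁) (hsol : (0 : Y) ∈ generalizedSum f F y) (k : ℕ) :
    γ * ‖y - x (k + 1)‖ ≤ u - scalarNewtonSeq u (k + 1) := by
  have hγ := h.majorant.γ_pos
  induction k with
  | zero =>
    rw [zero_add, h1, h.params.scalarNewtonSeq_one]
    exact h.norm_solution_sub_x₁_le_sub hy hyb hsol
  | succ k ih =>
    have ht := h.params.scalarNewtonSeq_lt (k + 1)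
    have hw : x (k + 1 + 1) ∈ partialLinearizationInv f F (x (k + 1)) 0 ∩ ball x₁ rx₁ := by
      rw [hmem]; rfl
    refine (h.newton_rate_succ (h.params.β_le_scalarNewtonSeq k) ht (hx₀ _) hw.1 hw.2 hy hyb hsol
      ih).trans ?_
    rw [scalarNewtonSeq_succ u (k + 1), scalarNewtonStep, sub_sub_cancel]
    have := h.params.discr_pos ht
    have := h.params.one_sub_u_pos
    gcongr

/-- The rates of the first step, from `x₀` to `x₁`. -/
theorem newton_rate_zero (h : NewtonSetting f F x₀ x₁ lam γ u β rx₁ r₀) {y : X}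
    (hy : γ * ‖y - x₀‖ ≤ u) (hyb : y ∈ ball x₁ rx₁) (hsol : (0 : Y) ∈ generalizedSum f F y) :
    γ * ‖y - x₁‖ ≤ 1 / 2 * (γ * ‖y - x₀‖) ∧
      (0 < 2 * (1 - u) ^ 2 - 1 →
        γ * ‖y - x₁‖ ≤ (γ * ‖y - x₀‖) ^ 2 / ((1 - u) * (2 * (1 - u) ^ 2 - 1))) := by
  have hγ := h.majorant.γ_pos
  have hu := h.params.u_lt_one
  have hu' := h.params.u_lt
  have hu0 := h.params.u_pos
  have hp := h.params.one_sub_u_pos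
  have hβ := h.params.β_pos
  obtain ⟨τ, hτ⟩ : ∃ τ, τ = γ * ‖y - x₀‖ := ⟨_, rfl⟩
  have hτ0 : 0 ≤ τ := by rw [hτ]; positivity
  rw [← hτ] at hy ⊢
  have hτ1 : 0 < 1 - τ := by linarith
  -- If the residual of `y` at `x₀` passes the threshold test, the estimate at base `x₀` applies;
  -- otherwise `τ > β/(1 - u)`, and the bound `γ‖y - x₁‖ ≤ u - β` is enough.
  by_cases hR : τ ^ 2 / (1 - τ) ≤ β ^ 2 / (1 - u) ^ 3
  · have hle : γ * ‖y - x₁‖ ≤ τ ^ 2 / (1 - τ) := by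
      have := h.norm_solution_sub_newton_le (x := x₀) (t := 0) (T := τ) (by simp) hu0 h.mem
        (mem_ball_self h.rx₁_pos) hτ.ge (by linarith) hyb hsol (by rw [← hτ]; simpa using hR)
      rw [← hτ] at this
      norm_num at this
      exact this
    refine ⟨hle.trans ?_, fun hD => hle.trans ?_⟩
    · rw [div_le_iff₀ hτ1]; nlinarith
    · have : (1 - u) * (2 * (1 - u) ^ 2 - 1) ≤ 1 - τ := by nlinarith
      gcongr
  · push Not at hR
    have hle := h.norm_solution_sub_x₁_le_sub (by rwa [← hτ]) hyb hsol
    rw [h.params.u_sub_β] at hle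
    have h1 : (β / (1 - u)) ^ 2 < τ ^ 2 := by
      have h2 : τ ^ 2 / (1 - τ) ≤ τ ^ 2 / (1 - u) := by gcongr
      have h3 := hR.trans_le h2
      have e : β ^ 2 / (1 - u) ^ 3 = (β / (1 - u)) ^ 2 / (1 - u) := by field_simp
      rw [e, div_lt_div_iff_of_pos_right hp] at h3
      exact h3
    have h2 : β / (1 - u) < τ := lt_of_pow_lt_pow_left₀ 2 hτ0 h1
    refine ⟨hle.trans ?_, fun hD => hle.trans ?_⟩
    -- `(β - 2u²)(1 - u) = u (2(1 - u)² - 1)`.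
    · have h3 : 2 * u ^ 2 ≤ β := by
        refine le_of_mul_le_mul_right ?_ hp
        rw [h.params.eq]
        nlinarith [h.params.nonneg]
      calc u ^ 2 / (1 - u) = 1 / 2 * (2 * u ^ 2 / (1 - u)) := by ring
        _ ≤ 1 / 2 * (β / (1 - u)) := by gcongr
        _ ≤ _ := by linarith
    · rw [← div_div, div_right_comm]
      gcongr
      rw [le_div_iff₀ hD]
      refine le_trans ?_ h1.le
      rw [h.params.β_eq, div_div, div_pow, le_div_iff₀ (by positivity)]
      have h3 : (1 - u) ^ 4 ≤ 1 := pow_le_one₀ hp.le (by linarith)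
      -- `2(1 - u)² - 1 = (1 - 2u)² - 2u²`.
      have h4 : (2 * (1 - u) ^ 2 - 1) * (1 - u) ^ 4 ≤ (1 - 2 * u) ^ 2 := by
        calc _ ≤ (2 * (1 - u) ^ 2 - 1) * 1 := by gcongr
          _ ≤ _ := by nlinarith [sq_nonneg u]
      calc _ = u ^ 2 * ((2 * (1 - u) ^ 2 - 1) * (1 - u) ^ 4) := by ring
        _ ≤ u ^ 2 * (1 - 2 * u) ^ 2 := by gcongr
        _ = _ := by ring

end NewtonSetting

end Newton

/-! ### From the hypotheses on `b`, `γ`, `r₀` to the scaled setting, and the conclusion. -/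

section Main

theorem mul_smaleTStar {b γ : ℝ} (hγ : 0 < γ) :
    γ * smaleTStar b γ = (b * γ + 1 - Real.sqrt ((b * γ + 1) ^ 2 - 8 * (b * γ))) / 4 := by
  rw [smaleTStar]; field_simp

theorem two_mul_sq_sub_one_nonneg {p : ℝ} (hp : Real.sqrt 2 / 2 ≤ p) : 0 ≤ 2 * p ^ 2 - 1 := by
  have h0 := Real.sqrt_nonneg 2
  have h2 : Real.sqrt 2 ^ 2 = 2 := Real.sq_sqrt (by norm_num)
  nlinarith

theorem two_mul_sq_sub_one_pos {p : ℝ} (hp : Real.sqrt 2 / 2 < p) : 0 < 2 * p ^ 2 - 1 := by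
  have h0 := Real.sqrt_nonneg 2
  have h2 : Real.sqrt 2 ^ 2 = 2 := Real.sq_sqrt (by norm_num)
  nlinarith

theorem smaleParameters_of_le {b γ : ℝ} (hb : 0 < b) (hγ : 0 < γ)
    (hbγ : b * γ ≤ 3 - 2 * Real.sqrt 2) :
    SmaleParameters (γ * smaleTStar b γ) (b * γ) := by
  have hβ : 0 < b * γ := mul_pos hb hγ
  rw [mul_smaleTStar hγ]
  obtain ⟨β, hβd⟩ : ∃ β, β = b * γ := ⟨_, rfl⟩
  rw [← hβd] at hβ hbγ ⊢
  have h2 : Real.sqrt 2 ^ 2 = 2 := Real.sq_sqrt (by norm_num)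
  have h0 := Real.sqrt_nonneg 2
  have h1 : 1 < Real.sqrt 2 := by nlinarith
  -- The discriminant factors as `(3 - 2√2 - β)(3 + 2√2 - β)`.
  have hnn : 0 ≤ (β + 1) ^ 2 - 8 * β := by nlinarith
  have hw := Real.sq_sqrt hnn
  have hw0 := Real.sqrt_nonneg ((β + 1) ^ 2 - 8 * β)
  set w := Real.sqrt ((β + 1) ^ 2 - 8 * β)
  refine ⟨?_, by linarith, by linear_combination hw / 8, two_mul_sq_sub_one_nonneg (by linarith)⟩
  have : w < β + 1 := by nlinarith
  linarith

theorem newtonSetting_of_isRegularityRadii {X Y : Type*}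
    [NormedAddCommGroup X] [NormedSpace ℝ X] [NormedAddCommGroup Y] [NormedSpace ℝ Y]
    {Ω : Set X} {f : X → Y} {F : X → Set Y} {x₀ x₁ : X} {lam γ b rx₁ r₀ rx₀ : ℝ}
    (hmaj : SmaleMajorant f x₀ lam γ) (hball : ball x₀ (1 / γ) ⊆ Ω)
    (hx₁ : x₁ ∈ partialLinearizationInv f F x₀ 0)
    (hb : 0 < b) (hx₁b : ‖x₁ - x₀‖ ≤ b) (hbγ : b * γ ≤ 3 - 2 * Real.sqrt 2)
    (hrad : IsRegularityRadii Ω f F x₀ x₁ lam rx₁ r₀ rx₀) (ht : smaleTStar b γ ≤ rx₀)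
    (hr : 4 ^ 3 * γ * b ^ 2 /
        (lam * (3 - b * γ + Real.sqrt ((b * γ + 1) ^ 2 - 8 * (b * γ))) ^ 3) < r₀) :
    NewtonSetting f F x₀ x₁ lam γ (γ * smaleTStar b γ) (b * γ) rx₁ r₀ := by
  have hγ := hmaj.γ_pos
  have hlam := hmaj.lam_pos
  have hpar := smaleParameters_of_le hb hγ hbγ
  have hmem : ∀ x, γ * ‖x - x₀‖ < γ * smaleTStar b γ → x ∈ ball x₀ rx₀ ∩ Ω := fun x hx => by
    refine ⟨?_, hball ?_⟩
    · rw [mem_ball_iff_norm]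
      exact (lt_of_mul_lt_mul_left hx hγ.le).trans_le ht
    · rw [mem_ball_iff_norm, lt_div_iff₀ hγ]
      linarith [hpar.u_lt_one]
  refine ⟨hmaj, hpar, fun x hx => hrad.lt_one x (hmem x hx),
    fun x hx => hrad.singleValued x (hmem x hx), hrad.rx₁_pos, hrad.r₀_pos, hx₁, ?_, ?_⟩
  · rw [mul_comm b]
    gcongr
  · have hp := hpar.one_sub_u_pos
    -- This identity turns the hypothesis on `r₀` into `β²/(1 - u)³ < γ lam r₀`.
    have e : 3 - b * γ + Real.sqrt ((b * γ + 1) ^ 2 - 8 * (b * γ)) =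
        4 * (1 - γ * smaleTStar b γ) := by rw [mul_smaleTStar hγ]; ring
    rw [e] at hr
    calc (b * γ) ^ 2 / (1 - γ * smaleTStar b γ) ^ 3 =
        γ * (lam * (4 ^ 3 * γ * b ^ 2 / (lam * (4 * (1 - γ * smaleTStar b γ)) ^ 3))) := by
          field_simp
      _ < γ * (lam * r₀) := by gcongr

end Main

theorem theorem4p7 {X Y : Type*}
    [NormedAddCommGroup X] [NormedSpace ℝ X] [CompleteSpace X]
    [NormedAddCommGroup Y] [NormedSpace ℝ Y] [CompleteSpace Y]
    (Ω : Set X) (hΩ : IsOpen Ω) (f : X → Y) (hf : AnalyticOnNhd ℝ f Ω)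
    (F : X → Set Y) (hF : IsClosed {p : X × Y | p.2 ∈ F p.1})
    (x₀ x₁ : X) (hx₀ : x₀ ∈ Ω) (hx₁ : x₁ ∈ Ω) (lam : ℝ)
    (hreg : StronglyRegular Set.univ (fun x => f x₀ + fderiv ℝ f x₀ (x - x₀)) F x₁ 0 lam)
    (γ : ℝ) (hγ : IsLUB (smaleSet f x₀ lam) γ) (hγ0 : 0 < γ)
    (hball : ball x₀ (1 / γ) ⊆ Ω)
    (b : ℝ) (hb : 0 < b) (hx₁b : ‖x₁ - x₀‖ ≤ b) (hbγ : b * γ ≤ 3 - 2 * Real.sqrt 2) :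
    (∃ rx₁ r₀ rx₀ : ℝ, IsRegularityRadii Ω f F x₀ x₁ lam rx₁ r₀ rx₀) ∧
    ∀ rx₁ r₀ rx₀ : ℝ, IsRegularityRadii Ω f F x₀ x₁ lam rx₁ r₀ rx₀ →
      smaleTStar b γ ≤ rx₀ →
      4 ^ 3 * γ * b ^ 2 /
        (lam * (3 - b * γ + Real.sqrt ((b * γ + 1) ^ 2 - 8 * (b * γ))) ^ 3) < r₀ →
      ∃ x : ℕ → X, x 0 = x₀ ∧
        (∀ k, partialLinearizationInv f F (x k) 0 ∩ ball x₁ rx₁ = {x (k + 1)}) ∧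
        (∀ k, x k ∈ ball x₀ (smaleTStar b γ)) ∧
        ∃ xs : X, Tendsto x atTop (𝓝 xs) ∧
          xs ∈ closedBall x₀ (smaleTStar b γ) ∩ ball x₁ rx₁ ∧
          (0 : Y) ∈ generalizedSum f F xs ∧
          (∀ y ∈ closedBall x₀ (smaleTStar b γ) ∩ ball x₁ rx₁,
            (0 : Y) ∈ generalizedSum f F y → y = xs) ∧
          (∀ k, ‖xs - x (k + 1)‖ ≤ 1 / 2 * ‖xs - x k‖) ∧
          (b * γ < 3 - 2 * Real.sqrt 2 →
            ∀ k, ‖xs - x (k + 1)‖ ≤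
              γ / ((1 - γ * smaleTStar b γ) * (2 * (1 - γ * smaleTStar b γ) ^ 2 - 1)) *
                ‖xs - x k‖ ^ 2) := by
  obtain ⟨hx₁m, hlam, -⟩ := hreg.mem_and_singleValuedLipschitz
  refine ⟨exists_isRegularityRadii (hf x₀ hx₀) hreg, fun rx₁ r₀ rx₀ hrad ht hr => ?_⟩
  have hmaj := smaleMajorant_of_analyticOnNhd hf hlam hγ0 hγ.1 hball
  have h := newtonSetting_of_isRegularityRadii hmaj hball hx₁m hb hx₁b hbγ hrad ht hr
  have hclosed : ∀ y, y ∈ closedBall x₀ (smaleTStar b γ) ↔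
      γ * ‖y - x₀‖ ≤ γ * smaleTStar b γ := fun y => by
    rw [mem_closedBall_iff_norm, mul_le_mul_iff_right₀ hγ0]
  obtain ⟨x, hx0, hx1, hmem, hdist, hstep⟩ := h.exists_newton_sequence
  obtain ⟨xs, hxs, hxsdist⟩ := h.exists_limit hstep
  have hxs₀ : γ * ‖xs - x₀‖ ≤ γ * smaleTStar b γ := by
    simpa [hx0, scalarNewtonSeq] using hxsdist 0
  have hxs₁ : γ * ‖xs - x₁‖ ≤ γ * smaleTStar b γ - b * γ := by
    simpa [hx1, h.params.scalarNewtonSeq_one] using hxsdist 1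
  obtain ⟨hxsb, hsol⟩ := h.limit_mem hmem hxs hxs₀ hxs₁
  have hmem' : ∀ k, x (k + 1) ∈ partialLinearizationInv f F (x k) 0 ∩ ball x₁ rx₁ := fun k => by
    rw [hmem]; rfl
  have hzero := h.newton_rate_zero hxs₀ hxsb hsol
  have hsucc : ∀ k, γ * ‖xs - x (k + 1 + 1)‖ ≤ (γ * ‖xs - x (k + 1)‖) ^ 2 /
      ((1 - γ * smaleTStar b γ) * (2 * (1 - scalarNewtonSeq (γ * smaleTStar b γ) (k + 1)) ^ 2 - 1)) :=
    fun k => h.newton_rate_succ (h.params.β_le_scalarNewtonSeq k) (h.params.scalarNewtonSeq_lt _)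
      (hdist _) (hmem' _).1 (hmem' _).2 hxs₀ hxsb hsol (hxsdist _)
  have hp := h.params.one_sub_u_pos
  refine ⟨x, hx0, hmem, fun k => ?_, xs, hxs, ⟨(hclosed xs).2 hxs₀, hxsb⟩, hsol, ?_, ?_, ?_⟩
  · rw [mem_ball_iff_norm]
    exact lt_of_mul_lt_mul_left ((hdist k).trans_lt (h.params.scalarNewtonSeq_lt k)) hγ0.le
  · intro y hy hysol
    -- The scalar gaps tend to `0`, so the iterates converge to `y` as well as to `xs`.
    have hle := h.norm_solution_sub_iterate_le hx1 hmem hdist ((hclosed y).1 hy.1) hy.2 hysol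
    have h1 : Tendsto (fun k => γ * ‖y - x (k + 1)‖) atTop (𝓝 (γ * ‖y - xs‖)) :=
      ((((tendsto_add_atTop_iff_nat 1).2 hxs).const_sub y).norm).const_mul γ
    have h2 := le_of_tendsto_of_tendsto' h1
      ((tendsto_add_atTop_iff_nat 1).2 h.params.tendsto_u_sub_scalarNewtonSeq) hle
    have h3 : ‖y - xs‖ ≤ 0 := by
      refine le_of_mul_le_mul_left ?_ hγ0
      rwa [mul_zero]
    exact sub_eq_zero.1 (norm_le_zero_iff.1 h3)
  · intro k
    refine le_of_mul_le_mul_left ?_ hγ0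
    rcases k with _ | k
    · rw [zero_add, hx1, hx0]
      linarith [hzero.1]
    · refine (hsucc k).trans ?_
      have htu := h.params.scalarNewtonSeq_lt (k + 1)
      have hD := h.params.discr_pos htu
      rw [div_le_iff₀ (by positivity)]
      have h1 := h.params.two_mul_sub_le (scalarNewtonSeq (γ * smaleTStar b γ) (k + 1))
      have h2 : 2 * (γ * ‖xs - x (k + 1)‖) ≤ (1 - γ * smaleTStar b γ) *
          (2 * (1 - scalarNewtonSeq (γ * smaleTStar b γ) (k + 1)) ^ 2 - 1) := by
        linarith [hxsdist (k + 1)]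
      have h3 : 0 ≤ γ * ‖xs - x (k + 1)‖ := by positivity
      nlinarith
  · intro hlt k
    have hD : 0 < 2 * (1 - γ * smaleTStar b γ) ^ 2 - 1 := by
      refine two_mul_sq_sub_one_pos ?_
      rw [mul_smaleTStar hγ0]
      linarith [Real.sqrt_nonneg ((b * γ + 1) ^ 2 - 8 * (b * γ))]
    refine le_of_mul_le_mul_left ?_ hγ0
    have key : γ * ‖xs - x (k + 1)‖ ≤ (γ * ‖xs - x k‖) ^ 2 /
        ((1 - γ * smaleTStar b γ) * (2 * (1 - γ * smaleTStar b γ) ^ 2 - 1)) := by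
      rcases k with _ | k
      · rw [zero_add, hx1, hx0]
        exact hzero.2 hD
      · refine (hsucc k).trans ?_
        have htu := h.params.scalarNewtonSeq_lt (k + 1)
        -- The scalar iterate is below `u`, so putting `u` in its place only shrinks the
        -- denominator.
        gcongr
    refine key.trans (le_of_eq ?_)
    ring
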